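/- **Languages.** Let $\mathsf{PROP},\mathsf{FVAR},\mathsf{NOM},\mathsf{CNOM}$ be disjoint countably infinite sets of propositional variables $p$, fixed point variables $X$, nominals $\mathbf i,\mathbf j$ and co-nominals $\mathbf m,\mathbf n$. The formulas of $\mathcal L_1$ are built from $\bot,\top,p,X$ by $\wedge,\vee,\to,-,\Diamond,\Box$ and by the binders $\mu X.\varphi$, $\nu X.\varphi$, allowed when every free occurrence of $X$ in $\varphi$ is positive; signs are inherited by subformulas, except that they are reversed in the left argument of $\to$ and the right argument of $-$. The formulas of $\mathcal L^+_*$ are built likewise with, in addition, nominals, co-nominals and the unary connectives $\blacklozenge,\blacksquare$, and with binders $\mu^*,\nu^*$ in place of $\mu,\nu$. For $\varphi\in\mathcal L_1$, $\varphi^*$ is obtained by replacing $\mu,\nu$ by $\mu^*,\nu^*$. An $\mathcal L_1$-inequality is an expression $\varphi\le\psi$ in which $\varphi,\psi\in\mathcal L_1$ have no free fixed point variables. A formula is positive (negative) in $p$ if all occurrences of $p$ in it are positive (negative). **Algebras.** A modal bi-Heyting algebra $\mathbf A$ is a bounded lattice $A$ with operations $\to,-$ satisfying $a\wedge b\le c\Leftrightarrow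 a\le b\to c$ and $a-b\le c\Leftrightarrow a\le b\vee c$, and with $\Box$ preserving finite meets and $\Diamond$ preserving finite joins (including the empty ones). In $\mathbf A$, $\mu X.\varphi$ is interpreted as $\bigwedge\{a\in A\mid \varphi(a)\le a\}$ and $\nu X.\varphi$ as $\bigvee\{a\in A\mid a\le\varphi(a)\}$, if these exist; $\mathbf A$ is a mu-algebra of the first kind if every $\mathcal L_1$-formula is defined under every assignment of its variables in $A$. $\mathbf A\models\varphi\le\psi$ means that the inequality holds under all assignments. The canonical extension $\mathbf A^\delta$ is the (up to isomorphism over $A$ unique) completely distributive complete lattice containing $A$ as a bounded sublattice such that every element is a join of closed elements (meets of subsets of $A$) and a meet of open elements (joins of subsets of $A$), and such that for $S,T\subseteq A$, $\bigwedge S\le\bigvee T$ implies $\bigwedge S'\le\bigvee T'$ for some finite $S'\subseteq S$, $T'\subseteq T$. On $\mathbf A^\delta$, $\to$ and $-$ are the residuals of $\wedge$ and $\vee$; with $k$ ranging over closed and $u$ over open elements, $$\Diamond c=\bigvee_{k\le c\le u}\bigwedge\{\Diamond a\mid a\in A,\,k\le a\le u\},\qquad \Box c=\bigwedge_{k\le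 c\le u}\bigvee\{\Box a\mid a\in A,\,k\le a\le u\};$$ $\blacksquare$ is the right adjoint of $\Diamond$ and $\blacklozenge$ the left adjoint of $\Box$. In $\mathbf A^\delta$, $\mu^*X.\varphi:=\bigwedge\{a\in A\mid\varphi(a)\le a\}$ and $\nu^*X.\varphi:=\bigvee\{a\in A\mid a\le\varphi(a)\}$. Assignments on $\mathbf A^\delta$ send propositional variables to arbitrary elements, nominals to completely join-irreducible and co-nominals to completely meet-irreducible elements. An $\mathcal L_1$-inequality $\varphi\le\psi$ is *tame canonical* if for every mu-algebra $\mathbf A$ of the first kind: $\mathbf A\models\varphi\le\psi$ if and only if $\mathbf A^\delta\models\varphi^*\le\psi^*$. **Tame runs of $\mu^*$-ALBA.** A tame run on $\varphi\le\psi$ proceeds as follows. 1. *Preprocessing.* Starting from the set consisting of $\varphi\le\psi$ alone, apply finitely often to one of the current inequalities: in $+(\text{left side})$ and $-(\text{right side})$, distribute a positive $\Diamond$ or $\wedge$ over a positive $\vee$, or a negative $\Box$ or $\vee$ over a negative $\wedge$; replace $\alpha\vee\beta\le\gamma$ by $\alpha\le\gamma$ and $\beta\le\gamma$; replace $\alpha\le\beta\wedge\gamma$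 by $\alpha\le\beta$ and $\alpha\le\gamma$; replace $\alpha(p)\le\beta(p)$ by $\alpha(\bot)\le\beta(\bot)$ if $\alpha$ is negative and $\beta$ positive in $p$, and by $\alpha(\top)\le\beta(\top)$ if $\alpha$ is positive and $\beta$ negative in $p$. 2. *Starring and first approximation.* Each resulting inequality $\eta\le\beta$ is replaced by the quasi-inequality $\mathbf j\le\eta^*\ \&\ \beta^*\le\mathbf m\Rightarrow\mathbf j\le\mathbf m$, which is treated separately from then on. 3. *Rules*, applied finitely often to inequalities of the antecedent. - Residuation: $\chi-\psi\le\varphi$ becomes $\chi\le\psi\vee\varphi$; $\varphi\le\chi\to\psi$ becomes $\varphi\wedge\chi\le\psi$; $\chi\wedge\psi\le\varphi$ becomes $\chi\le\psi\to\varphi$ or $\psi\le\chi\to\varphi$; $\varphi\le\chi\vee\psi$ becomes $\varphi-\chi\le\psi$ or $\varphi-\psi\le\chi$. - Adjunction: $\varphi\vee\chi\le\psi$ becomes $\varphi\le\psi\ \&\ \chi\le\psi$; $\psi\le\varphi\wedge\chi$ becomes $\psi\le\varphi\ \&\ \psi\le\chi$; $\Diamond\varphi\le\psi$ becomes $\varphi\le\blacksquare\psi$;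 $\varphi\le\Box\psi$ becomes $\blacklozenge\varphi\le\psi$. - Approximation, where the new (co-)nominals do not occur in the quasi-inequality: $\Box\psi\le\mathbf m$ becomes $\Box\mathbf n\le\mathbf m\ \&\ \psi\le\mathbf n$; $\mathbf j\le\Diamond\psi$ becomes $\mathbf j\le\Diamond\mathbf i\ \&\ \mathbf i\le\psi$; $\chi\to\varphi\le\mathbf m$ becomes $\mathbf j\to\mathbf n\le\mathbf m\ \&\ \mathbf j\le\chi\ \&\ \varphi\le\mathbf n$; $\mathbf i\le\chi-\varphi$ becomes $\mathbf i\le\mathbf j-\mathbf n\ \&\ \mathbf j\le\chi\ \&\ \varphi\le\mathbf n$. - Right Ackermann rule: $\&_{i=1}^n\alpha_i\le p\ \&\ \&_{j}\beta_j(p)\le\gamma_j(p)$ becomes $\&_j\,\beta_j(\bigvee_i\alpha_i)\le\gamma_j(\bigvee_i\alpha_i)$, if the $\alpha_i$ are $p$-free and syntactically closed, the $\beta_j$ positive in $p$ and syntactically closed, the $\gamma_j$ negative in $p$ and syntactically open, and all other inequalities of the quasi-inequality are $p$-free. - Left Ackermann rule: $\&_{i=1}^n p\le\alpha_i\ \&\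 \&_{j}\gamma_j(p)\le\beta_j(p)$ becomes $\&_j\,\gamma_j(\bigwedge_i\alpha_i)\le\beta_j(\bigwedge_i\alpha_i)$, if the $\alpha_i$ are $p$-free and syntactically open, the $\beta_j$ positive in $p$ and syntactically open, the $\gamma_j$ negative in $p$ and syntactically closed, and all other inequalities of the quasi-inequality are $p$-free. Here a formula of $\mathcal L^+_*$ is *syntactically open* if all occurrences of nominals, $\blacklozenge$ and $\mu^*$ in it are negative and all occurrences of co-nominals, $\blacksquare$ and $\nu^*$ are positive; it is *syntactically closed* if all occurrences of nominals, $\blacklozenge$ and $\mu^*$ are positive and all occurrences of co-nominals, $\blacksquare$ and $\nu^*$ are negative. (The full algorithm $\mu^*$-ALBA has two further rules, the approximation rules for fixed point binders; a run is tame if it never uses them.) The run *succeeds* if none of the final quasi-inequalities contains a propositional variable. **Theorem (Tame Canonicity).** Every $\mathcal L_1$-inequality on which some tame run of $\mu^*$-ALBA succeeds is tame canonical. -/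

import Mathlib

universe u v

namespace MuALBA

/-! ## Modal bi-Heyting algebras -/

/-- A bi-Heyting algebra with an operation `box` that preserves finite meets and an operation
`dia` that preserves finite joins. The implication is `a ⇨ b`, the subtraction is `a \ b`. -/
class ModalBiHeyting (A : Type u) extends BiheytingAlgebra A where
  box : A → A
  dia : A → A
  box_top : box ⊤ = ⊤
  box_inf : ∀ a b, box (a ⊓ b) = box a ⊓ box b
  dia_bot : dia ⊥ = ⊥
  dia_sup : ∀ a b, dia (a ⊔ b) = dia a ⊔ dia b

/-! ## Formulas -/

/-- Formulas with propositional variables, fixed point variables, nominals and co-nominals (all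
indexed by `ℕ`). `sub` is the subtraction, `bbox` and `bdia` are the adjoint (black) modalities,
`mu`, `nu` are the plain binders and `muS`, `nuS` the starred binders. -/
inductive Form : Type
  | bot : Form
  | top : Form
  | prop (p : ℕ) : Form
  | fvar (X : ℕ) : Form
  | nom (j : ℕ) : Form
  | cnom (m : ℕ) : Form
  | and (φ ψ : Form) : Form
  | or (φ ψ : Form) : Form
  | imp (φ ψ : Form) : Form
  | sub (φ ψ : Form) : Form
  | dia (φ : Form) : Form
  | box (φ : Form) : Form
  | bbox (φ : Form) : Form
  | bdia (φ : Form) : Form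
  | mu (X : ℕ) (φ : Form) : Form
  | nu (X : ℕ) (φ : Form) : Form
  | muS (X : ℕ) (φ : Form) : Form
  | nuS (X : ℕ) (φ : Form) : Form

namespace Form

/-- The propositional variables that occur in a formula. -/
def props : Form → Finset ℕ
  | bot | top | fvar _ | nom _ | cnom _ => ∅
  | prop p => {p}
  | and φ ψ | or φ ψ | imp φ ψ | sub φ ψ => φ.props ∪ ψ.props
  | dia φ | box φ | bbox φ | bdia φ => φ.props
  | mu _ φ | nu _ φ | muS _ φ | nuS _ φ => φ.props

/-- The nominals that occur in a formula. -/
def noms : Form → Finset ℕ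
  | bot | top | fvar _ | prop _ | cnom _ => ∅
  | nom j => {j}
  | and φ ψ | or φ ψ | imp φ ψ | sub φ ψ => φ.noms ∪ ψ.noms
  | dia φ | box φ | bbox φ | bdia φ => φ.noms
  | mu _ φ | nu _ φ | muS _ φ | nuS _ φ => φ.noms

/-- The co-nominals that occur in a formula. -/
def cnoms : Form → Finset ℕ
  | bot | top | fvar _ | prop _ | nom _ => ∅
  | cnom m => {m}
  | and φ ψ | or φ ψ | imp φ ψ | sub φ ψ => φ.cnoms ∪ ψ.cnoms
  | dia φ | box φ | bbox φ | bdia φ => φ.cnoms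
  | mu _ φ | nu _ φ | muS _ φ | nuS _ φ => φ.cnoms

/-- The fixed point variables that occur free in a formula. -/
def freeVars : Form → Finset ℕ
  | bot | top | prop _ | nom _ | cnom _ => ∅
  | fvar X => {X}
  | and φ ψ | or φ ψ | imp φ ψ | sub φ ψ => φ.freeVars ∪ ψ.freeVars
  | dia φ | box φ | bbox φ | bdia φ => φ.freeVars
  | mu X φ | nu X φ | muS X φ | nuS X φ => φ.freeVars.erase X

/-- A sentence has no free fixed point variables. -/
def IsSentence (φ : Form) : Prop := φ.freeVars = ∅

/-- `PropSign p s φ`: in the generation tree of `φ` whose root has sign `s` (`true` is `+`,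
`false` is `-`), every node labelled by the propositional variable `p` has sign `+`. -/
def PropSign (p : ℕ) : Bool → Form → Prop
  | _, bot | _, top | _, fvar _ | _, nom _ | _, cnom _ => True
  | s, prop q => q = p → s = true
  | s, and φ ψ | s, or φ ψ => PropSign p s φ ∧ PropSign p s ψ
  | s, imp φ ψ => PropSign p (!s) φ ∧ PropSign p s ψ
  | s, sub φ ψ => PropSign p s φ ∧ PropSign p (!s) ψ
  | s, dia φ | s, box φ | s, bbox φ | s, bdia φ => PropSign p s φ
  | s, mu _ φ | s, nu _ φ | s, muS _ φ | s, nuS _ φ => PropSign p s φ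

/-- `φ` is positive in `p`: all `p`-nodes of the tree `+φ` are signed `+`. -/
def PosIn (p : ℕ) (φ : Form) : Prop := PropSign p true φ

/-- `φ` is negative in `p`: all `p`-nodes of the tree `+φ` are signed `-`, that is, all `p`-nodes
of the tree `-φ` are signed `+`. -/
def NegIn (p : ℕ) (φ : Form) : Prop := PropSign p false φ

/-- `VarSign X s φ`: in the generation tree of `φ` whose root has sign `s`, every free occurrence
of the fixed point variable `X` has sign `+`. -/
def VarSign (X : ℕ) : Bool → Form → Prop
  | _, bot | _, top | _, prop _ | _, nom _ | _, cnom _ => True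
  | s, fvar Y => Y = X → s = true
  | s, and φ ψ | s, or φ ψ => VarSign X s φ ∧ VarSign X s ψ
  | s, imp φ ψ => VarSign X (!s) φ ∧ VarSign X s ψ
  | s, sub φ ψ => VarSign X s φ ∧ VarSign X (!s) ψ
  | s, dia φ | s, box φ | s, bbox φ | s, bdia φ => VarSign X s φ
  | s, mu Y φ | s, nu Y φ | s, muS Y φ | s, nuS Y φ => Y = X ∨ VarSign X s φ

/-- The formulas of the language with the plain binders `μ` and `ν` (no nominals, co-nominals,
black modalities or starred binders), where the body of a binder is positive in the bound
variable. -/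
def IsL1 : Form → Prop
  | bot | top | prop _ | fvar _ => True
  | and φ ψ | or φ ψ | imp φ ψ | sub φ ψ => IsL1 φ ∧ IsL1 ψ
  | dia φ | box φ => IsL1 φ
  | mu X φ | nu X φ => IsL1 φ ∧ VarSign X true φ
  | nom _ | cnom _ | bbox _ | bdia _ | muS _ _ | nuS _ _ => False

/-- `φ.star` replaces all occurrences of `μ` and `ν` by `μ*` and `ν*`. -/
def star : Form → Form
  | bot => bot
  | top => top
  | prop p => prop p
  | fvar X => fvar X
  | nom j => nom j
  | cnom m => cnom m
  | and φ ψ => and φ.star ψ.star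
  | or φ ψ => or φ.star ψ.star
  | imp φ ψ => imp φ.star ψ.star
  | sub φ ψ => sub φ.star ψ.star
  | dia φ => dia φ.star
  | box φ => box φ.star
  | bbox φ => bbox φ.star
  | bdia φ => bdia φ.star
  | mu X φ => muS X φ.star
  | nu X φ => nuS X φ.star
  | muS X φ => muS X φ.star
  | nuS X φ => nuS X φ.star

/-- Substitution of `α` for the propositional variable `p`. It is only ever used with a sentence
`α`, so that no variable can be captured. -/
def subst (p : ℕ) (α : Form) : Form → Form
  | bot => bot
  | top => top
  | prop q => if q = p then α else prop q
  | fvar X => fvar X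
  | nom j => nom j
  | cnom m => cnom m
  | and φ ψ => and (subst p α φ) (subst p α ψ)
  | or φ ψ => or (subst p α φ) (subst p α ψ)
  | imp φ ψ => imp (subst p α φ) (subst p α ψ)
  | sub φ ψ => sub (subst p α φ) (subst p α ψ)
  | dia φ => dia (subst p α φ)
  | box φ => box (subst p α φ)
  | bbox φ => bbox (subst p α φ)
  | bdia φ => bdia (subst p α φ)
  | mu X φ => mu X (subst p α φ)
  | nu X φ => nu X (subst p α φ)
  | muS X φ => muS X (subst p α φ)
  | nuS X φ => nuS X (subst p α φ)

/-- The disjunction of a finite list (`⊥` for the empty list). -/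
def bigOr : List Form → Form
  | [] => bot
  | [φ] => φ
  | φ :: ψ :: l => or φ (bigOr (ψ :: l))

/-- The conjunction of a finite list (`⊤` for the empty list). -/
def bigAnd : List Form → Form
  | [] => top
  | [φ] => φ
  | φ :: ψ :: l => and φ (bigAnd (ψ :: l))

/-- `SynOC true` are the syntactically open formulas and `SynOC false` the syntactically closed
formulas, by simultaneous recursion. Fixed point variables are treated like propositional
variables: they range over the elements of the original algebra. -/
def SynOC : Bool → Form → Prop
  | _, bot | _, top | _, prop _ | _, fvar _ => True
  | b, cnom _ => b = true
  | b, nom _ => b = false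
  | b, and φ ψ | b, or φ ψ => SynOC b φ ∧ SynOC b ψ
  | b, imp φ ψ => SynOC (!b) φ ∧ SynOC b ψ
  | b, sub φ ψ => SynOC b φ ∧ SynOC (!b) ψ
  | b, dia φ | b, box φ => SynOC b φ
  | b, bbox φ => b = true ∧ SynOC b φ
  | b, bdia φ => b = false ∧ SynOC b φ
  | b, nuS _ φ => b = true ∧ SynOC b φ
  | b, muS _ φ => b = false ∧ SynOC b φ
  | _, mu _ _ | _, nu _ _ => False

/-- Syntactically open formulas. -/
def SynOpen (φ : Form) : Prop := SynOC true φ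

/-- Syntactically closed formulas. -/
def SynClosed (φ : Form) : Prop := SynOC false φ

end Form

/-! ## Interpretation in a modal bi-Heyting algebra -/

section Algebra

variable {A : Type u} [ModalBiHeyting A]

/-- `Denotes v φ ρ a`: under the assignment `v` of the propositional variables and `ρ` of the free
fixed point variables, the formula `φ` is defined in `A` and its value is `a`. A least fixed point
is the meet in `A` of the set of pre-fixed points, if this meet exists, and a greatest fixed point
the join of the set of post-fixed points, if this join exists. Formulas outside the language with
the plain binders have no value. -/
def Denotes (v : ℕ → A) : Form → (ℕ → A) → A → Prop
  | .bot, _, a => a = ⊥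
  | .top, _, a => a = ⊤
  | .prop p, _, a => a = v p
  | .fvar X, ρ, a => a = ρ X
  | .and φ ψ, ρ, a => ∃ b c, Denotes v φ ρ b ∧ Denotes v ψ ρ c ∧ a = b ⊓ c
  | .or φ ψ, ρ, a => ∃ b c, Denotes v φ ρ b ∧ Denotes v ψ ρ c ∧ a = b ⊔ c
  | .imp φ ψ, ρ, a => ∃ b c, Denotes v φ ρ b ∧ Denotes v ψ ρ c ∧ a = b ⇨ c
  | .sub φ ψ, ρ, a => ∃ b c, Denotes v φ ρ b ∧ Denotes v ψ ρ c ∧ a = b \ c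
  | .dia φ, ρ, a => ∃ b, Denotes v φ ρ b ∧ a = ModalBiHeyting.dia b
  | .box φ, ρ, a => ∃ b, Denotes v φ ρ b ∧ a = ModalBiHeyting.box b
  | .mu X φ, ρ, a => IsGLB {b | ∃ c, Denotes v φ (Function.update ρ X b) c ∧ c ≤ b} a
  | .nu X φ, ρ, a => IsLUB {b | ∃ c, Denotes v φ (Function.update ρ X b) c ∧ b ≤ c} a
  | .nom _, _, _ | .cnom _, _, _ | .bbox _, _, _ | .bdia _, _, _ => False
  | .muS _ _, _, _ | .nuS _ _, _, _ => False

variable (A) in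
/-- `A` is a mu-algebra of the first kind: every formula with the plain binders is defined under
every assignment. -/
def IsFirstKind : Prop :=
  ∀ φ : Form, φ.IsL1 → ∀ v ρ : ℕ → A, ∃ a, Denotes v φ ρ a

variable (A) in
/-- Validity of `φ ≤ ψ` in `A`: the inequality holds under every assignment. -/
def ValidIn (φ ψ : Form) : Prop :=
  ∀ (v ρ : ℕ → A) (a b : A), Denotes v φ ρ a → Denotes v ψ ρ b → a ≤ b

end Algebra

/-! ## Canonical extensions -/

section CanonicalExtension

/-- Completely join-irreducible elements of a complete lattice. -/
def IsCJI {C : Type v} [CompleteLattice C] (j : C) : Prop :=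
  ∀ S : Set C, j = sSup S → j ∈ S

/-- Completely meet-irreducible elements of a complete lattice. -/
def IsCMI {C : Type v} [CompleteLattice C] (m : C) : Prop :=
  ∀ S : Set C, m = sInf S → m ∈ S

variable {A : Type u} {C : Type v}

/-- The closed elements: meets of elements of the original lattice. -/
def IsClosedElt [CompleteLattice C] (e : A → C) (c : C) : Prop := ∃ S : Set A, c = sInf (e '' S)

/-- The open elements: joins of elements of the original lattice. -/
def IsOpenElt [CompleteLattice C] (e : A → C) (c : C) : Prop := ∃ S : Set A, c = sSup (e '' S)

/-- The embedding `e` of the bounded distributive lattice `A` in the completely distributive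
complete lattice `C` is a canonical extension: it is dense and compact. -/
structure IsCanonicalExtension [DistribLattice A] [BoundedOrder A] [CompletelyDistribLattice C]
    (e : BoundedLatticeHom A C) : Prop where
  injective : Function.Injective e
  dense_join : ∀ c : C, ∃ K : Set C, (∀ k ∈ K, IsClosedElt e k) ∧ c = sSup K
  dense_meet : ∀ c : C, ∃ U : Set C, (∀ u ∈ U, IsOpenElt e u) ∧ c = sInf U
  compact : ∀ S T : Set A, sInf (e '' S) ≤ sSup (e '' T) →
    ∃ S' T' : Finset A, (S' : Set A) ⊆ S ∧ (T' : Set A) ⊆ T ∧ S'.inf e ≤ T'.sup e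

/-- The sigma-extension of a map on `A` to the canonical extension. -/
def sigmaExt [CompleteLattice C] (e : A → C) (f : A → A) (c : C) : C :=
  sSup {d | ∃ k u, IsClosedElt e k ∧ IsOpenElt e u ∧ k ≤ c ∧ c ≤ u ∧
    d = sInf {x | ∃ a, k ≤ e a ∧ e a ≤ u ∧ x = e (f a)}}

/-- The pi-extension of a map on `A` to the canonical extension. -/
def piExt [CompleteLattice C] (e : A → C) (f : A → A) (c : C) : C :=
  sInf {d | ∃ k u, IsClosedElt e k ∧ IsOpenElt e u ∧ k ≤ c ∧ c ≤ u ∧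
    d = sSup {x | ∃ a, k ≤ e a ∧ e a ≤ u ∧ x = e (f a)}}

variable [ModalBiHeyting A] [CompletelyDistribLattice C]

/-- The diamond of the canonical extension. -/
def diaExt (e : A → C) : C → C := sigmaExt e ModalBiHeyting.dia

/-- The box of the canonical extension. -/
def boxExt (e : A → C) : C → C := piExt e ModalBiHeyting.box

/-- The right adjoint of the diamond of the canonical extension. -/
def bboxExt (e : A → C) (c : C) : C := sSup {d | diaExt e d ≤ c}

/-- The left adjoint of the box of the canonical extension. -/
def bdiaExt (e : A → C) (c : C) : C := sInf {d | c ≤ boxExt e d}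

/-- An assignment on a complete lattice sends propositional variables to arbitrary elements,
nominals to completely join-irreducible and co-nominals to completely meet-irreducible elements. -/
structure Assignment (C : Type v) [CompleteLattice C] where
  prop : ℕ → C
  nom : ℕ → C
  cnom : ℕ → C
  nom_cji : ∀ j, IsCJI (nom j)
  cnom_cmi : ∀ m, IsCMI (cnom m)

/-- The value of a formula in the canonical extension. The plain binders are interpreted by all
pre- and post-fixed points in `C`, the starred binders only by those that come from `A`. -/
def eval (e : A → C) (V : Assignment C) : Form → (ℕ → C) → C
  | .bot, _ => ⊥
  | .top, _ => ⊤
  | .prop p, _ => V.prop p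
  | .fvar X, ρ => ρ X
  | .nom j, _ => V.nom j
  | .cnom m, _ => V.cnom m
  | .and φ ψ, ρ => eval e V φ ρ ⊓ eval e V ψ ρ
  | .or φ ψ, ρ => eval e V φ ρ ⊔ eval e V ψ ρ
  | .imp φ ψ, ρ => eval e V φ ρ ⇨ eval e V ψ ρ
  | .sub φ ψ, ρ => eval e V φ ρ \ eval e V ψ ρ
  | .dia φ, ρ => diaExt e (eval e V φ ρ)
  | .box φ, ρ => boxExt e (eval e V φ ρ)
  | .bbox φ, ρ => bboxExt e (eval e V φ ρ)
  | .bdia φ, ρ => bdiaExt e (eval e V φ ρ)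
  | .mu X φ, ρ => sInf {c | eval e V φ (Function.update ρ X c) ≤ c}
  | .nu X φ, ρ => sSup {c | c ≤ eval e V φ (Function.update ρ X c)}
  | .muS X φ, ρ => sInf (e '' {a | eval e V φ (Function.update ρ X (e a)) ≤ e a})
  | .nuS X φ, ρ => sSup (e '' {a | e a ≤ eval e V φ (Function.update ρ X (e a))})

/-- Validity of `φ ≤ ψ` in the canonical extension: it holds under every assignment. -/
def ValidInExt (e : A → C) (φ ψ : Form) : Prop :=
  ∀ (V : Assignment C) (ρ : ℕ → C), eval e V φ ρ ≤ eval e V ψ ρ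

end CanonicalExtension

/-- `φ ≤ ψ` is tame canonical: for every mu-algebra `A` of the first kind, with canonical extension
`e : A → C`, the inequality is valid in `A` iff its starred version is valid in `C`. -/
def IsTameCanonical (φ ψ : Form) : Prop :=
  ∀ (A : Type u) [ModalBiHeyting A], IsFirstKind A →
    ∀ (C : Type v) [CompletelyDistribLattice C] (e : BoundedLatticeHom A C),
      IsCanonicalExtension e → (ValidIn A φ ψ ↔ ValidInExt e φ.star ψ.star)

/-- Every bounded distributive lattice has a canonical extension: the lattice of down-sets of prime
ideals. So the quantification over canonical extensions above is never empty. -/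
theorem exists_isCanonicalExtension (A : Type u) [DistribLattice A] [BoundedOrder A] :
    ∃ e : BoundedLatticeHom A (LowerSet {I : Order.Ideal A // I.IsPrime}),
      IsCanonicalExtension e := by
  let e : BoundedLatticeHom A (LowerSet {I : Order.Ideal A // I.IsPrime}) :=
    { toFun := fun a => ⟨{I | a ∉ I.1}, fun I J hJI ha hJ => ha (hJI hJ)⟩
      map_sup' := fun a b => by
        ext I
        change a ⊔ b ∉ I.1 ↔ a ∉ I.1 ∨ b ∉ I.1
        rw [Order.Ideal.sup_mem_iff, not_and_or]
      map_inf' := fun a b => by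
        ext I
        have h : a ⊓ b ∈ I.1 ↔ a ∈ I.1 ∨ b ∈ I.1 :=
          ⟨I.2.mem_or_mem, fun h => h.elim (I.1.lower inf_le_left) (I.1.lower inf_le_right)⟩
        change a ⊓ b ∉ I.1 ↔ a ∉ I.1 ∧ b ∉ I.1
        rw [h, not_or]
      map_top' := by
        ext I
        exact iff_of_true I.2.toIsProper.top_notMem trivial
      map_bot' := by
        ext I
        simp }
  have he : ∀ a I, I ∈ e a ↔ a ∉ I.1 := fun a I => Iff.rfl
  have hcompact : ∀ S T : Set A, sInf (e '' S) ≤ sSup (e '' T) →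
      ∃ S' T' : Finset A, (S' : Set A) ⊆ S ∧ (T' : Set A) ⊆ T ∧ S'.inf id ≤ T'.sup id := by
    classical
    intro S T hST
    by_contra! hno
    let F : Order.PFilter A := Order.IsPFilter.toPFilter
      (F := {x | ∃ S' : Finset A, (S' : Set A) ⊆ S ∧ S'.inf id ≤ x}) (by
        refine Order.IsPFilter.of_def ⟨⊤, ∅, by simp, le_top⟩ ?_ ?_
        · rintro x ⟨S₁, h₁, hx⟩ y ⟨S₂, h₂, hy⟩
          exact ⟨x ⊓ y, ⟨S₁ ∪ S₂, by simp [h₁, h₂],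
            by rw [Finset.inf_union]; exact inf_le_inf hx hy⟩, inf_le_left, inf_le_right⟩
        · rintro x y hxy ⟨S₁, h₁, hx⟩
          exact ⟨S₁, h₁, hx.trans hxy⟩)
    let I : Order.Ideal A := Order.IsIdeal.toIdeal
      (I := {x | ∃ T' : Finset A, (T' : Set A) ⊆ T ∧ x ≤ T'.sup id}) (by
        refine ⟨?_, ⟨⊥, ∅, by simp, bot_le⟩, ?_⟩
        · rintro x y hxy ⟨T₁, h₁, hx⟩
          exact ⟨T₁, h₁, le_trans hxy hx⟩
        · rintro x ⟨T₁, h₁, hx⟩ y ⟨T₂, h₂, hy⟩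
          exact ⟨x ⊔ y, ⟨T₁ ∪ T₂, by simp [h₁, h₂],
            by rw [Finset.sup_union]; exact sup_le_sup hx hy⟩, le_sup_left, le_sup_right⟩)
    have hFI : Disjoint (F : Set A) (I : Set A) := by
      rw [Set.disjoint_left]
      rintro x ⟨S', hS', hx⟩ ⟨T', hT', hx'⟩
      exact hno S' T' hS' hT' (hx.trans hx')
    obtain ⟨J, hJ, hIJ, hFJ⟩ := DistribLattice.prime_ideal_of_disjoint_filter_ideal hFI
    have h1 : (⟨J, hJ⟩ : {I : Order.Ideal A // I.IsPrime}) ∈ sInf (e '' S) := by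
      rw [LowerSet.mem_sInf_iff]
      rintro _ ⟨a, ha, rfl⟩
      rw [he]
      exact Set.disjoint_left.1 hFJ ⟨{a}, by simpa using ha, by simp⟩
    obtain ⟨_, ⟨b, hb, rfl⟩, h2⟩ := LowerSet.mem_sSup_iff.1 (hST h1)
    rw [he] at h2
    exact h2 (hIJ ⟨{b}, by simpa using hb, by simp⟩)
  refine ⟨e, ?_, ?_, ?_, ?_⟩
  · have key : ∀ a b, e a ≤ e b → a ≤ b := by
      intro a b hab
      obtain ⟨S', T', hS, hT, h⟩ := hcompact {a} {b} (by simpa using hab)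
      refine le_trans (Finset.le_inf fun x hx => ?_) (h.trans (Finset.sup_le fun x hx => ?_))
      · exact (hS hx : x = a) ▸ le_rfl
      · exact (hT hx : x = b) ▸ le_rfl
    exact fun a b hab => le_antisymm (key a b hab.le) (key b a hab.ge)
  · intro c
    refine ⟨{k | ∃ I ∈ c, k = sInf (e '' {a | a ∉ I.1})}, ?_, ?_⟩
    · rintro _ ⟨I, _, rfl⟩
      exact ⟨_, rfl⟩
    · ext J
      simp only [SetLike.mem_coe, LowerSet.mem_sSup_iff]
      constructor
      · intro hJ
        refine ⟨_, ⟨J, hJ, rfl⟩, ?_⟩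
        rw [LowerSet.mem_sInf_iff]
        rintro _ ⟨a, ha, rfl⟩
        exact ha
      · rintro ⟨_, ⟨I, hI, rfl⟩, hJ⟩
        rw [LowerSet.mem_sInf_iff] at hJ
        refine c.lower (show J ≤ I from fun a ha => ?_) hI
        by_contra hn
        exact hJ _ ⟨a, hn, rfl⟩ ha
  · intro c
    refine ⟨{k | ∃ I, I ∉ c ∧ k = sSup (e '' {a | a ∈ I.1})}, ?_, ?_⟩
    · rintro _ ⟨I, _, rfl⟩
      exact ⟨_, rfl⟩
    · ext J
      simp only [SetLike.mem_coe, LowerSet.mem_sInf_iff]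
      constructor
      · rintro hJ _ ⟨I, hI, rfl⟩
        rw [LowerSet.mem_sSup_iff]
        by_contra! hn
        refine hI (c.lower (show I ≤ J from fun a ha => ?_) hJ)
        by_contra hn'
        exact hn _ ⟨a, ha, rfl⟩ hn'
      · intro h
        by_contra hJ
        obtain ⟨_, ⟨a, ha, rfl⟩, h2⟩ := LowerSet.mem_sSup_iff.1 (h _ ⟨J, hJ, rfl⟩)
        exact h2 ha
  · intro S T hST
    obtain ⟨S', T', hS, hT, h⟩ := hcompact S T hST
    refine ⟨S', T', hS, hT, ?_⟩
    have := OrderHomClass.mono e h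
    rwa [map_finset_inf, map_finset_sup] at this

/-! ## Tame runs of the algorithm -/

/-- An inequality `lhs ≤ rhs`. -/
structure Ineq where
  lhs : Form
  rhs : Form

/-- `Distrib s φ φ'`: in the generation tree of `φ` with root sign `s`, one positive occurrence of
`◇` or `∧` is distributed over a positive occurrence of `∨`, or one negative occurrence of `□` or
`∨` is distributed over a negative occurrence of `∧`, which results in `φ'`. -/
inductive Distrib : Bool → Form → Form → Prop
  | dia_or (α β) : Distrib true (.dia (.or α β)) (.or (.dia α) (.dia β))
  | and_or_left (α β γ) :
      Distrib true (.and (.or α β) γ) (.or (.and α γ) (.and β γ))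
  | and_or_right (α β γ) :
      Distrib true (.and γ (.or α β)) (.or (.and γ α) (.and γ β))
  | box_and (α β) : Distrib false (.box (.and α β)) (.and (.box α) (.box β))
  | or_and_left (α β γ) :
      Distrib false (.or (.and α β) γ) (.and (.or α γ) (.or β γ))
  | or_and_right (α β γ) :
      Distrib false (.or γ (.and α β)) (.and (.or γ α) (.or γ β))
  | and_left {s φ φ'} (ψ) : Distrib s φ φ' → Distrib s (.and φ ψ) (.and φ' ψ)
  | and_right {s φ φ'} (ψ) : Distrib s φ φ' → Distrib s (.and ψ φ) (.and ψ φ')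
  | or_left {s φ φ'} (ψ) : Distrib s φ φ' → Distrib s (.or φ ψ) (.or φ' ψ)
  | or_right {s φ φ'} (ψ) : Distrib s φ φ' → Distrib s (.or ψ φ) (.or ψ φ')
  | imp_left {s φ φ'} (ψ) : Distrib (!s) φ φ' → Distrib s (.imp φ ψ) (.imp φ' ψ)
  | imp_right {s φ φ'} (ψ) : Distrib s φ φ' → Distrib s (.imp ψ φ) (.imp ψ φ')
  | sub_left {s φ φ'} (ψ) : Distrib s φ φ' → Distrib s (.sub φ ψ) (.sub φ' ψ)
  | sub_right {s φ φ'} (ψ) : Distrib (!s) φ φ' → Distrib s (.sub ψ φ) (.sub ψ φ')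
  | dia {s φ φ'} : Distrib s φ φ' → Distrib s (.dia φ) (.dia φ')
  | box {s φ φ'} : Distrib s φ φ' → Distrib s (.box φ) (.box φ')
  | mu {s φ φ'} (X) : Distrib s φ φ' → Distrib s (.mu X φ) (.mu X φ')
  | nu {s φ φ'} (X) : Distrib s φ φ' → Distrib s (.nu X φ) (.nu X φ')

/-- One preprocessing transformation, which turns an inequality into a list of inequalities. -/
inductive PreRule : Ineq → List Ineq → Prop
  | distrib_left {φ φ' ψ} : Distrib true φ φ' → PreRule ⟨φ, ψ⟩ [⟨φ', ψ⟩]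
  | distrib_right {φ ψ ψ'} : Distrib false ψ ψ' → PreRule ⟨φ, ψ⟩ [⟨φ, ψ'⟩]
  | orLA (α β γ) : PreRule ⟨.or α β, γ⟩ [⟨α, γ⟩, ⟨β, γ⟩]
  | andRA (α β γ) : PreRule ⟨α, .and β γ⟩ [⟨α, β⟩, ⟨α, γ⟩]
  | botElim {α β} (p) : α.NegIn p → β.PosIn p →
      PreRule ⟨α, β⟩ [⟨Form.subst p .bot α, Form.subst p .bot β⟩]
  | topElim {α β} (p) : α.PosIn p → β.NegIn p →
      PreRule ⟨α, β⟩ [⟨Form.subst p .top α, Form.subst p .top β⟩]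

/-- A preprocessing step applies a preprocessing transformation to one inequality of the list. -/
inductive PreStep : List Ineq → List Ineq → Prop
  | mk {I L} (L₁ L₂) : PreRule I L → PreStep (L₁ ++ I :: L₂) (L₁ ++ L ++ L₂)

/-- A quasi-inequality: the conjunction of the inequalities `ante` implies `cons`. -/
structure QuasiIneq where
  ante : Multiset Ineq
  cons : Ineq

namespace Ineq

/-- The propositional variable `p` does not occur. -/
def PropFree (p : ℕ) (I : Ineq) : Prop := p ∉ I.lhs.props ∧ p ∉ I.rhs.props

/-- The nominal `j` does not occur. -/
def NomFree (j : ℕ) (I : Ineq) : Prop := j ∉ I.lhs.noms ∧ j ∉ I.rhs.noms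

/-- The co-nominal `m` does not occur. -/
def CnomFree (m : ℕ) (I : Ineq) : Prop := m ∉ I.lhs.cnoms ∧ m ∉ I.rhs.cnoms

/-- An inequality without propositional variables. -/
def IsPure (I : Ineq) : Prop := I.lhs.props = ∅ ∧ I.rhs.props = ∅

/-- Substitution for a propositional variable on both sides. -/
def subst (p : ℕ) (α : Form) (I : Ineq) : Ineq := ⟨Form.subst p α I.lhs, Form.subst p α I.rhs⟩

end Ineq

namespace QuasiIneq

/-- The nominal `j` is fresh for the quasi-inequality. -/
def NomFresh (j : ℕ) (Q : QuasiIneq) : Prop := (∀ I ∈ Q.ante, I.NomFree j) ∧ Q.cons.NomFree j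

/-- The co-nominal `m` is fresh for the quasi-inequality. -/
def CnomFresh (m : ℕ) (Q : QuasiIneq) : Prop := (∀ I ∈ Q.ante, I.CnomFree m) ∧ Q.cons.CnomFree m

/-- A pure quasi-inequality contains no propositional variables. -/
def IsPure (Q : QuasiIneq) : Prop := (∀ I ∈ Q.ante, I.IsPure) ∧ Q.cons.IsPure

end QuasiIneq

/-- First approximation, applied to the starred version of an inequality. -/
def firstApprox (j m : ℕ) (I : Ineq) : QuasiIneq :=
  ⟨{⟨.nom j, I.lhs.star⟩, ⟨I.rhs.star, .cnom m⟩}, ⟨.nom j, .cnom m⟩⟩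

/-- The residuation and adjunction rules: an inequality is replaced by a conjunction of
inequalities. The residuation rules for `∧` and `∨` may be applied in either argument. -/
inductive LocalRule : Ineq → Multiset Ineq → Prop
  | subLR (χ ψ φ) : LocalRule ⟨.sub χ ψ, φ⟩ {⟨χ, .or ψ φ⟩}
  | impRR (φ χ ψ) : LocalRule ⟨φ, .imp χ ψ⟩ {⟨.and φ χ, ψ⟩}
  | andLR (χ ψ φ) : LocalRule ⟨.and χ ψ, φ⟩ {⟨χ, .imp ψ φ⟩}
  | andLR' (χ ψ φ) : LocalRule ⟨.and χ ψ, φ⟩ {⟨ψ, .imp χ φ⟩}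
  | orRR (φ χ ψ) : LocalRule ⟨φ, .or χ ψ⟩ {⟨.sub φ χ, ψ⟩}
  | orRR' (φ χ ψ) : LocalRule ⟨φ, .or χ ψ⟩ {⟨.sub φ ψ, χ⟩}
  | orLA (φ χ ψ) : LocalRule ⟨.or φ χ, ψ⟩ {⟨φ, ψ⟩, ⟨χ, ψ⟩}
  | andRA (ψ φ χ) : LocalRule ⟨ψ, .and φ χ⟩ {⟨ψ, φ⟩, ⟨ψ, χ⟩}
  | diaLA (φ ψ) : LocalRule ⟨.dia φ, ψ⟩ {⟨φ, .bbox ψ⟩}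
  | boxRA (φ ψ) : LocalRule ⟨φ, .box ψ⟩ {⟨.bdia φ, ψ⟩}

/-- One step of a tame run after first approximation: a residuation, adjunction, ordinary
approximation or Ackermann rule is applied to the antecedent of a quasi-inequality. The fixed point
approximation rules are absent, because a tame run does not use them. In the Ackermann rules, `R`
consists of the inequalities outside the scope of the quantified variable `p`. -/
inductive TameStep : QuasiIneq → QuasiIneq → Prop
  | loc {I S} (Γ : Multiset Ineq) (c : Ineq) : LocalRule I S →
      TameStep ⟨I ::ₘ Γ, c⟩ ⟨S + Γ, c⟩
  | boxAppr (ψ : Form) (m n : ℕ) (Γ : Multiset Ineq) (c : Ineq) :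
      QuasiIneq.CnomFresh n ⟨⟨.box ψ, .cnom m⟩ ::ₘ Γ, c⟩ →
      TameStep ⟨⟨.box ψ, .cnom m⟩ ::ₘ Γ, c⟩
        ⟨⟨.box (.cnom n), .cnom m⟩ ::ₘ ⟨ψ, .cnom n⟩ ::ₘ Γ, c⟩
  | diaAppr (ψ : Form) (j i : ℕ) (Γ : Multiset Ineq) (c : Ineq) :
      QuasiIneq.NomFresh i ⟨⟨.nom j, .dia ψ⟩ ::ₘ Γ, c⟩ →
      TameStep ⟨⟨.nom j, .dia ψ⟩ ::ₘ Γ, c⟩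
        ⟨⟨.nom j, .dia (.nom i)⟩ ::ₘ ⟨.nom i, ψ⟩ ::ₘ Γ, c⟩
  | impAppr (χ φ : Form) (m j n : ℕ) (Γ : Multiset Ineq) (c : Ineq) :
      QuasiIneq.NomFresh j ⟨⟨.imp χ φ, .cnom m⟩ ::ₘ Γ, c⟩ →
      QuasiIneq.CnomFresh n ⟨⟨.imp χ φ, .cnom m⟩ ::ₘ Γ, c⟩ →
      TameStep ⟨⟨.imp χ φ, .cnom m⟩ ::ₘ Γ, c⟩
        ⟨⟨.imp (.nom j) (.cnom n), .cnom m⟩ ::ₘ ⟨.nom j, χ⟩ ::ₘ ⟨φ, .cnom n⟩ ::ₘ Γ, c⟩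
  | subAppr (χ φ : Form) (i j n : ℕ) (Γ : Multiset Ineq) (c : Ineq) :
      QuasiIneq.NomFresh j ⟨⟨.nom i, .sub χ φ⟩ ::ₘ Γ, c⟩ →
      QuasiIneq.CnomFresh n ⟨⟨.nom i, .sub χ φ⟩ ::ₘ Γ, c⟩ →
      TameStep ⟨⟨.nom i, .sub χ φ⟩ ::ₘ Γ, c⟩
        ⟨⟨.nom i, .sub (.nom j) (.cnom n)⟩ ::ₘ ⟨.nom j, χ⟩ ::ₘ ⟨φ, .cnom n⟩ ::ₘ Γ, c⟩
  | rightAckermann (p : ℕ) (αs : List Form) (B R : Multiset Ineq) (c : Ineq) :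
      (∀ α ∈ αs, p ∉ α.props ∧ α.SynClosed) →
      (∀ I ∈ B, I.lhs.PosIn p ∧ I.lhs.SynClosed ∧ I.rhs.NegIn p ∧ I.rhs.SynOpen) →
      (∀ I ∈ R, I.PropFree p) → c.PropFree p →
      TameStep ⟨((αs.map fun α => (⟨α, .prop p⟩ : Ineq)) : Multiset Ineq) + B + R, c⟩
        ⟨B.map (Ineq.subst p (Form.bigOr αs)) + R, c⟩
  | leftAckermann (p : ℕ) (αs : List Form) (B R : Multiset Ineq) (c : Ineq) :
      (∀ α ∈ αs, p ∉ α.props ∧ α.SynOpen) →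
      (∀ I ∈ B, I.lhs.NegIn p ∧ I.lhs.SynClosed ∧ I.rhs.PosIn p ∧ I.rhs.SynOpen) →
      (∀ I ∈ R, I.PropFree p) → c.PropFree p →
      TameStep ⟨((αs.map fun α => (⟨.prop p, α⟩ : Ineq)) : Multiset Ineq) + B + R, c⟩
        ⟨B.map (Ineq.subst p (Form.bigAnd αs)) + R, c⟩

/-- Some tame run succeeds on the inequality `φ ≤ ψ`: preprocessing turns it into finitely many
inequalities, and from each of these, after starring and first approximation, finitely many steps
lead to a pure quasi-inequality. -/
def TameRunSucceeds (φ ψ : Form) : Prop :=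
  ∃ L : List Ineq, Relation.ReflTransGen PreStep [⟨φ, ψ⟩] L ∧
    ∀ I ∈ L, ∃ (j m : ℕ) (Q : QuasiIneq),
      Relation.ReflTransGen TameStep (firstApprox j m I) Q ∧ Q.IsPure

end MuALBA

/-!
The conclusion `j ≤ m` of a quasi-inequality separates the two sides of an inequality, so a failure
of `η ≤ β` in the canonical extension is a failure of its first approximation. Such a failure is
carried along the run to a pure quasi-inequality. There the values of the propositional variables
are irrelevant, so they may be replaced by elements of `A`, and the failure is carried back up the
run through assignments that send propositional variables into `A`.

Only the Ackermann rules need an argument on the way back, because the value of `⋁ᵢ αᵢ` is closed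
but need not lie in `A`. It is approximated from above by a filtered family of elements of `A`. By
compactness, an inequality between a syntactically closed and a syntactically open formula that
holds in the limit already holds at some element of the family; the starred binders do not disturb
this because they range over `A` only. Finally, if `A` is a mu-algebra of the first kind, the
starred binders agree with the true fixed points under assignments into `A`.
-/

namespace MuALBA

open scoped Filter

/-! ## Canonical extensions -/

theorem directedOn_image2 {α β γ : Type*} {r : α → α → Prop} {s : β → β → Prop} {t : γ → γ → Prop}
    {f : α → β → γ} {S : Set α} {T : Set β} (hS : DirectedOn r S) (hT : DirectedOn s T)
    (hf : ∀ ⦃a a' b b'⦄, r a a' → s b b' → t (f a b) (f a' b')) :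
    DirectedOn t (Set.image2 f S T) := by
  rw [← Set.image_prod]
  exact (hS.prod hT).mono_comp fun _ _ h => hf h.1 h.2

section ClosedOpen

variable {A : Type u} {C : Type v}

theorem IsCJI.exists_le [Order.Frame C] {j : C} (hj : IsCJI j) {S : Set C}
    (h : j ≤ sSup S) : ∃ s ∈ S, j ≤ s := by
  have hsup : j = sSup ((j ⊓ ·) '' S) := by rw [sSup_image, ← inf_sSup_eq, inf_eq_left.2 h]
  obtain ⟨s, hs, hjs⟩ := hj _ hsup
  exact ⟨s, hs, inf_eq_left.1 hjs⟩

theorem IsCMI.exists_le [Order.Coframe C] {m : C} (hm : IsCMI m) {S : Set C}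
    (h : sInf S ≤ m) : ∃ s ∈ S, s ≤ m :=
  IsCJI.exists_le (C := Cᵒᵈ) hm h

variable [CompleteLattice C]

section Map

variable {e : A → C}

theorem isClosedElt_map (a : A) : IsClosedElt e (e a) := ⟨{a}, by simp⟩

theorem isOpenElt_map (a : A) : IsOpenElt e (e a) := ⟨{a}, by simp⟩

theorem IsClosedElt.sInf_image_setOf_le {k : C} (hk : IsClosedElt e k) :
    sInf (e '' {a | k ≤ e a}) = k := by
  obtain ⟨S, rfl⟩ := hk
  refine le_antisymm (sInf_le_sInf (Set.image_mono fun a ha => sInf_le ⟨a, ha, rfl⟩)) (le_sInf ?_)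
  rintro _ ⟨a, ha, rfl⟩
  exact ha

theorem IsOpenElt.sSup_image_setOf_le {u : C} (hu : IsOpenElt e u) :
    sSup (e '' {a | e a ≤ u}) = u :=
  IsClosedElt.sInf_image_setOf_le (C := Cᵒᵈ) hu

theorem piExt_eq_sigmaExt_dual (f : A → A) (c : C) :
    piExt e f c = sigmaExt (C := Cᵒᵈ) e f c := by
  have hset (k u : C) : {x | ∃ a, k ≤ e a ∧ e a ≤ u ∧ x = e (f a)} =
      {x | ∃ a, e a ≤ u ∧ k ≤ e a ∧ x = e (f a)} := by simp only [and_left_comm]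
  refine congrArg (sInf : Set C → C) (Set.ext fun d => ⟨?_, ?_⟩)
  · rintro ⟨k, u, hk, hu, hkc, hcu, rfl⟩
    exact ⟨u, k, hu, hk, hcu, hkc, congrArg (sSup : Set C → C) (hset k u)⟩
  · rintro ⟨u, k, hu, hk, hcu, hkc, rfl⟩
    exact ⟨k, u, hk, hu, hkc, hcu, congrArg (sSup : Set C → C) (hset k u).symm⟩

end Map

variable [Lattice A] [BoundedOrder A] {e : BoundedLatticeHom A C}

theorem directedOn_ge_setOf_le_map (c : C) : DirectedOn (· ≥ ·) {a | c ≤ e a} :=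
  fun a ha b hb => ⟨a ⊓ b, (le_inf ha hb).trans_eq (map_inf e a b).symm, inf_le_left, inf_le_right⟩

theorem directedOn_le_setOf_map_le (c : C) : DirectedOn (· ≤ ·) {a | e a ≤ c} :=
  directedOn_ge_setOf_le_map (e := BoundedLatticeHom.dual e) c

end ClosedOpen

section CanonicalExtension

variable {A : Type u} {C : Type v} [DistribLattice A] [BoundedOrder A] [CompletelyDistribLattice C]
  {e : BoundedLatticeHom A C}

theorem IsCanonicalExtension.dual (he : IsCanonicalExtension e) :
    IsCanonicalExtension (BoundedLatticeHom.dual e) where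
  injective := he.injective
  dense_join := he.dense_meet
  dense_meet := he.dense_join
  compact S T h := by
    obtain ⟨S', T', hS, hT, h'⟩ := he.compact T S h
    exact ⟨T', S', hT, hS, h'⟩

theorem IsCanonicalExtension.map_le_map_iff (he : IsCanonicalExtension e) {a b : A} :
    e a ≤ e b ↔ a ≤ b := by
  rw [← inf_eq_left, ← map_inf, he.injective.eq_iff, inf_eq_left]

theorem IsCanonicalExtension.exists_map_le_of_directedOn (he : IsCanonicalExtension e) {S : Set A}
    (hne : S.Nonempty) (hS : DirectedOn (· ≥ ·) S) {u : C} (hu : IsOpenElt e u)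
    (h : sInf (e '' S) ≤ u) : ∃ a ∈ S, e a ≤ u := by
  obtain ⟨T, rfl⟩ := hu
  obtain ⟨S', T', hS', hT', hST⟩ := he.compact S T h
  obtain ⟨a, ha, haS'⟩ : ∃ a ∈ S, a ≤ S'.inf id := by
    refine Finset.inf_induction (p := fun x => ∃ a ∈ S, a ≤ x) (hne.imp fun a ha => ⟨ha, le_top⟩)
      ?_ fun b hb => ⟨b, hS' hb, le_rfl⟩
    rintro x ⟨a, ha, hax⟩ y ⟨b, hb, hby⟩
    obtain ⟨c, hc, hca, hcb⟩ := hS a ha b hb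
    exact ⟨c, hc, le_inf (hca.trans hax) (hcb.trans hby)⟩
  refine ⟨a, ha, (he.map_le_map_iff.2 haS').trans ?_⟩
  rw [map_finset_inf]
  exact hST.trans (Finset.sup_le fun b hb => le_sSup ⟨b, hT' hb, rfl⟩)

theorem IsCanonicalExtension.exists_le_map_of_directedOn (he : IsCanonicalExtension e) {S : Set A}
    (hne : S.Nonempty) (hS : DirectedOn (· ≤ ·) S) {k : C} (hk : IsClosedElt e k)
    (h : k ≤ sSup (e '' S)) : ∃ a ∈ S, k ≤ e a :=
  he.dual.exists_map_le_of_directedOn hne hS hk h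

theorem IsCanonicalExtension.exists_between (he : IsCanonicalExtension e) {k u : C}
    (hk : IsClosedElt e k) (hu : IsOpenElt e u) (h : k ≤ u) : ∃ a, k ≤ e a ∧ e a ≤ u :=
  he.exists_map_le_of_directedOn ⟨⊤, by simp⟩ (directedOn_ge_setOf_le_map k) hu
    (hk.sInf_image_setOf_le.trans_le h)

theorem IsCanonicalExtension.le_of_forall_isOpenElt (he : IsCanonicalExtension e) {c d : C}
    (h : ∀ u, IsOpenElt e u → d ≤ u → c ≤ u) : c ≤ d := by
  obtain ⟨U, hU, rfl⟩ := he.dense_meet d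
  exact le_sInf fun u hu => h u (hU u hu) (sInf_le hu)

theorem IsCanonicalExtension.le_of_forall_isClosedElt (he : IsCanonicalExtension e) {c d : C}
    (h : ∀ k, IsClosedElt e k → k ≤ c → k ≤ d) : c ≤ d :=
  he.dual.le_of_forall_isOpenElt h

theorem IsCanonicalExtension.exists_map_inf_le (he : IsCanonicalExtension e) {k l u : C}
    (hk : IsClosedElt e k) (hl : IsClosedElt e l) (hu : IsOpenElt e u) (h : k ⊓ l ≤ u) :
    ∃ a b, k ≤ e a ∧ l ≤ e b ∧ e (a ⊓ b) ≤ u := by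
  have hle : sInf (e '' Set.image2 (· ⊓ ·) {a | k ≤ e a} {b | l ≤ e b}) ≤ k ⊓ l := by
    nth_rw 2 [← hk.sInf_image_setOf_le, ← hl.sInf_image_setOf_le]
    refine le_inf (sInf_le_sInf (Set.image_mono fun a ha => ?_))
      (sInf_le_sInf (Set.image_mono fun b hb => ?_))
    · exact ⟨a, ha, ⊤, by simp, inf_top_eq a⟩
    · exact ⟨⊤, by simp, b, hb, top_inf_eq b⟩
  obtain ⟨_, ⟨a, ha, b, hb, rfl⟩, hab⟩ := he.exists_map_le_of_directedOn
    (Set.Nonempty.image2 ⟨⊤, by simp⟩ ⟨⊤, by simp⟩) (directedOn_image2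
      (directedOn_ge_setOf_le_map k) (directedOn_ge_setOf_le_map l)
      fun _ _ _ _ ha hb => inf_le_inf ha hb) hu (hle.trans h)
  exact ⟨a, b, ha, hb, hab⟩

end CanonicalExtension

/-! ## Completely irreducible elements -/

section Irreducible

variable {A : Type u} {C : Type v} [DistribLattice A] [BoundedOrder A] [CompletelyDistribLattice C]
  {e : BoundedLatticeHom A C}

theorem IsCanonicalExtension.isClosedElt_of_isCJI (he : IsCanonicalExtension e) {j : C}
    (hj : IsCJI j) : IsClosedElt e j := by
  obtain ⟨K, hK, h⟩ := he.dense_join j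
  exact hK j (hj K h)

theorem IsCanonicalExtension.isOpenElt_of_isCMI (he : IsCanonicalExtension e) {m : C}
    (hm : IsCMI m) : IsOpenElt e m :=
  he.dual.isClosedElt_of_isCJI hm

theorem IsCanonicalExtension.isCJI_sInf_image_compl (he : IsCanonicalExtension e) {S : Set A}
    (h : ¬ sInf (e '' Sᶜ) ≤ sSup (e '' S)) : IsCJI (sInf (e '' Sᶜ)) := by
  intro T hT
  by_contra hmem
  refine h (hT.trans_le (sSup_le fun t ht => ?_))
  have hlt : ¬ sInf (e '' Sᶜ) ≤ t := fun hle =>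
    hmem (le_antisymm hle ((le_sSup ht).trans_eq hT.symm) ▸ ht)
  obtain ⟨u, hu, htu, hSu⟩ : ∃ u, IsOpenElt e u ∧ t ≤ u ∧ ¬ sInf (e '' Sᶜ) ≤ u := by
    contrapose! hlt
    exact he.le_of_forall_isOpenElt hlt
  refine htu.trans (hu.sSup_image_setOf_le.ge.trans (sSup_le_sSup (Set.image_mono fun a ha => ?_)))
  by_contra haS
  exact hSu (sInf_le_of_le ⟨a, haS, rfl⟩ ha)

theorem IsCanonicalExtension.isCMI_sSup_image (he : IsCanonicalExtension e) {S : Set A}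
    (h : ¬ sInf (e '' Sᶜ) ≤ sSup (e '' S)) : IsCMI (sSup (e '' S)) := by
  rw [← compl_compl S] at h ⊢
  rw [compl_compl Sᶜ] at h
  exact he.dual.isCJI_sInf_image_compl h

theorem exists_isPrime_of_not_le {C : Type v} [CompleteLattice C]
    {e : BoundedLatticeHom A C} {c d : C} (h : ¬ c ≤ d) :
    ∃ P : Order.Ideal A, P.IsPrime ∧ {a | e a ≤ d} ⊆ (P : Set A) ∧
      {a | c ≤ e a} ⊆ (P : Set A)ᶜ := by
  have hfilter : Order.IsPFilter {a | c ≤ e a} := .of_def ⟨⊤, by simp⟩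
    (directedOn_ge_setOf_le_map c) fun hab ha => le_trans ha (OrderHomClass.mono e hab)
  have hideal : Order.IsIdeal {a | e a ≤ d} :=
    ⟨fun a b hba ha => (OrderHomClass.mono e hba).trans ha, ⟨⊥, by simp⟩,
      directedOn_le_setOf_map_le d⟩
  have hdisj : Disjoint (hfilter.toPFilter : Set A) (hideal.toIdeal : Set A) :=
    Set.disjoint_left.2 fun a (hca : c ≤ e a) (had : e a ≤ d) => h (hca.trans had)
  obtain ⟨P, hP, hdP, hcP⟩ := DistribLattice.prime_ideal_of_disjoint_filter_ideal hdisj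
  exact ⟨P, hP, hdP, hcP.subset_compl_right⟩

theorem IsCanonicalExtension.not_sInf_image_compl_le_of_isPrime (he : IsCanonicalExtension e)
    {P : Order.Ideal A} (hP : P.IsPrime) : ¬ sInf (e '' (P : Set A)ᶜ) ≤ sSup (e '' P) := by
  intro hle
  let F : Order.PFilter A := hP.compl_filter.toPFilter
  obtain ⟨a, haP, ha⟩ := he.exists_map_le_of_directedOn F.nonempty F.directed ⟨_, rfl⟩ hle
  obtain ⟨b, hbP, hb⟩ :=
    he.exists_le_map_of_directedOn P.nonempty P.directed (isClosedElt_map a) ha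
  exact haP (P.lower (he.map_le_map_iff.1 hb) hbP)

theorem IsCanonicalExtension.exists_isCJI_isCMI_of_not_le (he : IsCanonicalExtension e) {c d : C}
    (h : ¬ c ≤ d) : ∃ j m : C, IsCJI j ∧ IsCMI m ∧ j ≤ c ∧ d ≤ m ∧ ¬ j ≤ m := by
  obtain ⟨k, hk, hkc, hkd⟩ : ∃ k, IsClosedElt e k ∧ k ≤ c ∧ ¬ k ≤ d := by
    contrapose! h
    exact he.le_of_forall_isClosedElt h
  obtain ⟨u, hu, hdu, hku⟩ : ∃ u, IsOpenElt e u ∧ d ≤ u ∧ ¬ k ≤ u := by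
    contrapose! hkd
    exact he.le_of_forall_isOpenElt hkd
  obtain ⟨P, hP, huP, hkP⟩ := exists_isPrime_of_not_le (e := e) hku
  have hne := he.not_sInf_image_compl_le_of_isPrime hP
  refine ⟨_, _, he.isCJI_sInf_image_compl hne, he.isCMI_sSup_image hne, ?_, ?_, hne⟩
  · exact (sInf_le_sInf (Set.image_mono hkP)).trans (hk.sInf_image_setOf_le.trans_le hkc)
  · exact hdu.trans (hu.sSup_image_setOf_le.ge.trans (sSup_le_sSup (Set.image_mono huP)))

theorem IsCanonicalExtension.sSup_setOf_isCJI_le (he : IsCanonicalExtension e) (c : C) :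
    sSup {j | IsCJI j ∧ j ≤ c} = c := by
  refine le_antisymm (sSup_le fun j hj => hj.2) ?_
  by_contra h
  obtain ⟨j, m, hj, -, hjc, hm, hjm⟩ := he.exists_isCJI_isCMI_of_not_le h
  exact hjm (sSup_le_iff.1 hm j ⟨hj, hjc⟩)

theorem IsCanonicalExtension.sInf_setOf_isCMI_ge (he : IsCanonicalExtension e) (c : C) :
    sInf {m | IsCMI m ∧ c ≤ m} = c :=
  he.dual.sSup_setOf_isCJI_le c

theorem IsCanonicalExtension.exists_isCJI_isCMI_le_sdiff (he : IsCanonicalExtension e) {i c d : C}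
    (hi : IsCJI i) (h : i ≤ c \ d) :
    ∃ j n, IsCJI j ∧ IsCMI n ∧ i ≤ j \ n ∧ j ≤ c ∧ d ≤ n := by
  have hle : c \ d ≤ sSup {x | ∃ j n, IsCJI j ∧ IsCMI n ∧ j ≤ c ∧ d ≤ n ∧ x = j \ n} := by
    rw [sdiff_le_iff]
    by_contra hnle
    obtain ⟨j, m, hj, hm, hjc, hdm, hjm⟩ := he.exists_isCJI_isCMI_of_not_le hnle
    obtain ⟨hdm, hsup⟩ := sup_le_iff.1 hdm
    have hsdiff : j \ m ≤ m := sSup_le_iff.1 hsup _ ⟨j, m, hj, hm, hjc, hdm, rfl⟩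
    rw [sdiff_le_iff, sup_idem] at hsdiff
    exact hjm hsdiff
  obtain ⟨_, ⟨j, n, hj, hn, hjc, hdn, rfl⟩, hijn⟩ := hi.exists_le (h.trans hle)
  exact ⟨j, n, hj, hn, hijn, hjc, hdn⟩

theorem IsCanonicalExtension.exists_isCJI_isCMI_himp_le (he : IsCanonicalExtension e) {m c d : C}
    (hm : IsCMI m) (h : c ⇨ d ≤ m) :
    ∃ j n, IsCJI j ∧ IsCMI n ∧ j ⇨ n ≤ m ∧ j ≤ c ∧ d ≤ n := by
  obtain ⟨n, j, hn, hj, hle, hdn, hjc⟩ := he.dual.exists_isCJI_isCMI_le_sdiff hm h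
  exact ⟨j, n, hj, hn, hle, hjc, hdn⟩

end Irreducible

/-! ## Residuals -/

section Heyting

variable {A : Type u} {C : Type v} [HeytingAlgebra A] [CompletelyDistribLattice C]
  {e : BoundedLatticeHom A C}

theorem IsCanonicalExtension.map_himp (he : IsCanonicalExtension e) (a b : A) :
    e (a ⇨ b) = e a ⇨ e b := by
  refine le_antisymm ?_ (he.le_of_forall_isClosedElt fun k hk h => ?_)
  · rw [le_himp_iff, ← map_inf]
    exact he.map_le_map_iff.2 himp_inf_le
  · obtain ⟨c, d, hkc, had, hcd⟩ :=
      he.exists_map_inf_le hk (isClosedElt_map a) (isOpenElt_map b) (le_himp_iff.1 h)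
    rw [he.map_le_map_iff] at had hcd
    exact hkc.trans (he.map_le_map_iff.2 (le_himp_iff.2 ((inf_le_inf_left c had).trans hcd)))

theorem IsCanonicalExtension.exists_map_himp_le (he : IsCanonicalExtension e) {w k u : C}
    (hw : IsOpenElt e w) (hk : IsClosedElt e k) (hu : IsOpenElt e u) (h : w ⇨ k ≤ u) :
    ∃ a b, e a ≤ w ∧ k ≤ e b ∧ e (a ⇨ b) ≤ u := by
  have hle : sInf (e '' Set.image2 (· ⇨ ·) {a | e a ≤ w} {b | k ≤ e b}) ≤ w ⇨ k := by
    refine le_himp_comm.1 (hw.sSup_image_setOf_le.ge.trans (sSup_le ?_))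
    rintro _ ⟨a, ha, rfl⟩
    refine le_himp_comm.1 (le_himp_iff.2 ((le_sInf ?_).trans_eq hk.sInf_image_setOf_le))
    rintro _ ⟨b, hb, rfl⟩
    rw [← le_himp_iff, ← he.map_himp]
    exact sInf_le ⟨_, ⟨a, ha, b, hb, rfl⟩, rfl⟩
  obtain ⟨_, ⟨a, ha, b, hb, rfl⟩, hab⟩ := he.exists_map_le_of_directedOn
    (Set.Nonempty.image2 ⟨⊥, by simp⟩ ⟨⊤, by simp⟩) (directedOn_image2
      (directedOn_le_setOf_map_le w) (directedOn_ge_setOf_le_map k)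
      fun _ _ _ _ ha hb => himp_le_himp ha hb) hu (hle.trans h)
  exact ⟨a, b, ha, hb, hab⟩

theorem IsCanonicalExtension.exists_le_map_himp (he : IsCanonicalExtension e) {k w l : C}
    (hk : IsClosedElt e k) (hw : IsOpenElt e w) (hl : IsClosedElt e l) (h : l ≤ k ⇨ w) :
    ∃ a b, k ≤ e a ∧ e b ≤ w ∧ l ≤ e (a ⇨ b) := by
  obtain ⟨c, a, hlc, hka, hcaw⟩ := he.exists_map_inf_le hl hk hw (le_himp_iff.1 h)
  exact ⟨a, c ⊓ a, hka, hcaw, hlc.trans (he.map_le_map_iff.2 (le_himp_iff.2 le_rfl))⟩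

end Heyting

section Coheyting

variable {A : Type u} {C : Type v} [CoheytingAlgebra A] [CompletelyDistribLattice C]
  {e : BoundedLatticeHom A C}

theorem IsCanonicalExtension.map_sdiff (he : IsCanonicalExtension e) (a b : A) :
    e (a \ b) = e a \ e b :=
  he.dual.map_himp (A := Aᵒᵈ) b a

end Coheyting

/-! ## Extensions of monotone maps -/

section Extension

variable {A : Type u} {C : Type v} [DistribLattice A] [BoundedOrder A] [CompletelyDistribLattice C]
  {e : BoundedLatticeHom A C} {f : A → A}

theorem IsCanonicalExtension.sigmaExt_le_iff (he : IsCanonicalExtension e) (hf : Monotone f)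
    {c u : C} (hu : IsOpenElt e u) :
    sigmaExt e f c ≤ u ↔ ∀ k, IsClosedElt e k → k ≤ c → ∃ a, k ≤ e a ∧ e (f a) ≤ u := by
  refine ⟨fun h k hk hkc => ?_, fun h => sSup_le ?_⟩
  · have hle : sInf (e '' (f '' {a | k ≤ e a})) ≤ sigmaExt e f c := by
      refine le_sSup_of_le ⟨k, ⊤, hk, ⟨{⊤}, by simp⟩, hkc, le_top, rfl⟩ (le_sInf ?_)
      rintro _ ⟨a, hka, -, rfl⟩
      exact sInf_le ⟨f a, ⟨a, hka, rfl⟩, rfl⟩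
    obtain ⟨_, ⟨a, hka, rfl⟩, hau⟩ := he.exists_map_le_of_directedOn
      (Set.Nonempty.image f ⟨⊤, by simp⟩)
      ((directedOn_ge_setOf_le_map k).mono_comp fun _ _ h => hf h) hu (hle.trans h)
    exact ⟨a, hka, hau⟩
  · rintro _ ⟨k, w, hk, hw, hkc, hcw, rfl⟩
    obtain ⟨a, hka, hau⟩ := h k hk hkc
    obtain ⟨b, hkb, hbw⟩ := he.exists_between hk hw (hkc.trans hcw)
    refine sInf_le_of_le ⟨a ⊓ b, ?_, ?_, rfl⟩ ((he.map_le_map_iff.2 (hf inf_le_left)).trans hau)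
    · exact (le_inf hka hkb).trans_eq (map_inf e a b).symm
    · exact (he.map_le_map_iff.2 inf_le_right).trans hbw

theorem IsCanonicalExtension.sigmaExt_mono (he : IsCanonicalExtension e) (hf : Monotone f) :
    Monotone (sigmaExt e f) := fun _ _ hcd => he.le_of_forall_isOpenElt fun _ hu h =>
  (he.sigmaExt_le_iff hf hu).2 fun k hk hkc =>
    (he.sigmaExt_le_iff hf hu).1 h k hk (hkc.trans hcd)

theorem IsCanonicalExtension.sigmaExt_le_iff_of_isClosedElt (he : IsCanonicalExtension e)
    (hf : Monotone f) {k u : C} (hk : IsClosedElt e k) (hu : IsOpenElt e u) :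
    sigmaExt e f k ≤ u ↔ ∃ a, k ≤ e a ∧ e (f a) ≤ u := by
  rw [he.sigmaExt_le_iff hf hu]
  exact ⟨fun h => h k hk le_rfl, fun ⟨a, ha, hau⟩ l _ hlk => ⟨a, hlk.trans ha, hau⟩⟩

theorem IsCanonicalExtension.sigmaExt_map (he : IsCanonicalExtension e) (hf : Monotone f)
    (a : A) : sigmaExt e f (e a) = e (f a) := by
  have hle {u : C} (hu : IsOpenElt e u) := he.sigmaExt_le_iff_of_isClosedElt hf
    (isClosedElt_map a) hu
  refine le_antisymm ((hle (isOpenElt_map _)).2 ⟨a, le_rfl, le_rfl⟩)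
    (he.le_of_forall_isOpenElt fun u hu h => ?_)
  obtain ⟨b, hab, hbu⟩ := (hle hu).1 h
  exact (he.map_le_map_iff.2 (hf (he.map_le_map_iff.1 hab))).trans hbu

theorem IsCanonicalExtension.exists_le_map_of_le_sigmaExt (he : IsCanonicalExtension e)
    (hf : Monotone f) {u k : C} (hu : IsOpenElt e u) (hk : IsClosedElt e k)
    (h : k ≤ sigmaExt e f u) : ∃ a, e a ≤ u ∧ k ≤ e (f a) := by
  have hle : sigmaExt e f u ≤ sSup (e '' (f '' {a | e a ≤ u})) := by
    refine (he.sigmaExt_le_iff hf ⟨_, rfl⟩).2 fun l hl hlu => ?_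
    obtain ⟨a, hla, hau⟩ := he.exists_between hl hu hlu
    exact ⟨a, hla, le_sSup ⟨f a, ⟨a, hau, rfl⟩, rfl⟩⟩
  obtain ⟨_, ⟨a, hau, rfl⟩, hka⟩ := he.exists_le_map_of_directedOn
    (Set.Nonempty.image f ⟨⊥, by simp⟩)
    ((directedOn_le_setOf_map_le u).mono_comp fun _ _ h => hf h) hk (h.trans hle)
  exact ⟨a, hau, hka⟩

theorem IsCanonicalExtension.gc_sigmaExt (he : IsCanonicalExtension e) (hbot : f ⊥ = ⊥)
    (hsup : ∀ a b, f (a ⊔ b) = f a ⊔ f b) :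
    GaloisConnection (sigmaExt e f) fun c => sSup {d | sigmaExt e f d ≤ c} := by
  have hf : Monotone f := .of_map_sup hsup
  refine fun d c => ⟨fun h => le_sSup h, fun h => (he.sigmaExt_mono hf h).trans ?_⟩
  refine he.le_of_forall_isOpenElt fun u hu hcu => (he.sigmaExt_le_iff hf hu).2 fun k hk hkc => ?_
  have hdirected : DirectedOn (· ≤ ·) {a | e (f a) ≤ u} := directedOn_of_sup_mem fun a b ha hb => by
    simpa only [Set.mem_ofPred_eq, hsup, map_sup, sup_le_iff] using ⟨ha, hb⟩
  have hle : sSup {d | sigmaExt e f d ≤ c} ≤ sSup (e '' {a | e (f a) ≤ u}) := by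
    refine sSup_le fun d hd => he.le_of_forall_isClosedElt fun l hl hld => ?_
    obtain ⟨a, hla, hau⟩ := (he.sigmaExt_le_iff hf hu).1 (le_trans hd hcu) l hl hld
    exact hla.trans (le_sSup ⟨a, hau, rfl⟩)
  obtain ⟨a, hau, hka⟩ := he.exists_le_map_of_directedOn ⟨⊥, by simp [hbot]⟩ hdirected hk
    (hkc.trans hle)
  exact ⟨a, hka, hau⟩

theorem IsCanonicalExtension.piExt_mono (he : IsCanonicalExtension e) (hf : Monotone f) :
    Monotone (piExt e f) := fun c d hcd => by
  simp only [piExt_eq_sigmaExt_dual]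
  exact he.dual.sigmaExt_mono hf.dual hcd

theorem IsCanonicalExtension.piExt_map (he : IsCanonicalExtension e) (hf : Monotone f) (a : A) :
    piExt e f (e a) = e (f a) :=
  (piExt_eq_sigmaExt_dual f (e a)).trans (he.dual.sigmaExt_map hf.dual a)

theorem IsCanonicalExtension.gc_piExt (he : IsCanonicalExtension e) (htop : f ⊤ = ⊤)
    (hinf : ∀ a b, f (a ⊓ b) = f a ⊓ f b) :
    GaloisConnection (fun c => sInf {d | c ≤ piExt e f d}) (piExt e f) := fun c d => by
  simp only [piExt_eq_sigmaExt_dual]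
  exact (he.dual.gc_sigmaExt htop hinf d c).symm

end Extension

/-! ## Modalities -/

section Modality

variable {A : Type u} {C : Type v} [ModalBiHeyting A] [CompletelyDistribLattice C]
  {e : BoundedLatticeHom A C}

theorem dia_mono : Monotone (ModalBiHeyting.dia : A → A) := .of_map_sup ModalBiHeyting.dia_sup

theorem box_mono : Monotone (ModalBiHeyting.box : A → A) := .of_map_inf ModalBiHeyting.box_inf

theorem IsCanonicalExtension.diaExt_map (he : IsCanonicalExtension e) (a : A) :
    diaExt e (e a) = e (ModalBiHeyting.dia a) :=
  he.sigmaExt_map dia_mono a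

theorem IsCanonicalExtension.boxExt_map (he : IsCanonicalExtension e) (a : A) :
    boxExt e (e a) = e (ModalBiHeyting.box a) :=
  he.piExt_map box_mono a

theorem IsCanonicalExtension.gc_diaExt_bboxExt (he : IsCanonicalExtension e) :
    GaloisConnection (diaExt e) (bboxExt e) :=
  he.gc_sigmaExt ModalBiHeyting.dia_bot ModalBiHeyting.dia_sup

theorem IsCanonicalExtension.gc_bdiaExt_boxExt (he : IsCanonicalExtension e) :
    GaloisConnection (bdiaExt e) (boxExt e) :=
  he.gc_piExt ModalBiHeyting.box_top ModalBiHeyting.box_inf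

theorem IsCanonicalExtension.exists_isCJI_le_diaExt (he : IsCanonicalExtension e) {j c : C}
    (hj : IsCJI j) (h : j ≤ diaExt e c) : ∃ i, IsCJI i ∧ j ≤ diaExt e i ∧ i ≤ c := by
  rw [← he.sSup_setOf_isCJI_le c, he.gc_diaExt_bboxExt.l_sSup, ← sSup_image] at h
  obtain ⟨_, ⟨i, ⟨hi, hic⟩, rfl⟩, hji⟩ := hj.exists_le h
  exact ⟨i, hi, hji, hic⟩

theorem IsCanonicalExtension.exists_isCMI_boxExt_le (he : IsCanonicalExtension e) {m c : C}
    (hm : IsCMI m) (h : boxExt e c ≤ m) : ∃ n, IsCMI n ∧ boxExt e n ≤ m ∧ c ≤ n := by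
  rw [← he.sInf_setOf_isCMI_ge c, he.gc_bdiaExt_boxExt.u_sInf, ← sInf_image] at h
  obtain ⟨_, ⟨n, ⟨hn, hcn⟩, rfl⟩, hnm⟩ := hm.exists_le h
  exact ⟨n, hn, hnm, hcn⟩

end Modality

/-! ## Limits of families in a canonical extension -/

section Limit

variable {A : Type u} {C : Type v} {ι : Type*}

/-- `c` is a closed limit of the family `F` along the filter `l`: below every open element above `c`
there is an element of `A` which bounds `c` and, eventually, `F`. In particular `c` is closed. -/
def IsClosedLimit [CompleteLattice C] (e : A → C) (l : Filter ι) (F : ι → C) (c : C) : Prop :=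
  ∀ u, IsOpenElt e u → c ≤ u → ∃ a, c ≤ e a ∧ e a ≤ u ∧ ∀ᶠ i in l, F i ≤ e a

/-- The order dual of `IsClosedLimit`. -/
def IsOpenLimit [CompleteLattice C] (e : A → C) (l : Filter ι) (F : ι → C) (c : C) : Prop :=
  ∀ k, IsClosedElt e k → k ≤ c → ∃ a, e a ≤ c ∧ k ≤ e a ∧ ∀ᶠ i in l, e a ≤ F i

section Map

variable [CompleteLattice C] {e : A → C} {l : Filter ι} {F : ι → C} {c : C}

theorem IsClosedLimit.eventually_le_map (hF : IsClosedLimit e l F c) {a : A} (h : c ≤ e a) :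
    ∀ᶠ i in l, F i ≤ e a := by
  obtain ⟨b, -, hba, hb⟩ := hF _ (isOpenElt_map a) h
  exact hb.mono fun i hi => hi.trans hba

theorem IsOpenLimit.eventually_map_le (hF : IsOpenLimit e l F c) {a : A} (h : e a ≤ c) :
    ∀ᶠ i in l, e a ≤ F i :=
  IsClosedLimit.eventually_le_map (C := Cᵒᵈ) hF h

end Map

section Lattice

variable [Lattice A] [BoundedOrder A] [CompleteLattice C] {e : BoundedLatticeHom A C}
  {l : Filter ι} {F G : ι → C} {c d : C}

theorem IsClosedLimit.sup (hF : IsClosedLimit e l F c) (hG : IsClosedLimit e l G d) :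
    IsClosedLimit e l (fun i => F i ⊔ G i) (c ⊔ d) := fun u hu h => by
  obtain ⟨a, hca, hau, ha⟩ := hF u hu (le_sup_left.trans h)
  obtain ⟨b, hdb, hbu, hb⟩ := hG u hu (le_sup_right.trans h)
  refine ⟨a ⊔ b, ?_, ?_, ?_⟩
  · exact (sup_le_sup hca hdb).trans_eq (map_sup e a b).symm
  · exact (map_sup e a b).trans_le (sup_le hau hbu)
  · filter_upwards [ha, hb] with i hi hi'
    exact (sup_le_sup hi hi').trans_eq (map_sup e a b).symm

theorem IsOpenLimit.inf (hF : IsOpenLimit e l F c) (hG : IsOpenLimit e l G d) :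
    IsOpenLimit e l (fun i => F i ⊓ G i) (c ⊓ d) :=
  IsClosedLimit.sup (e := BoundedLatticeHom.dual e) hF hG

end Lattice

section DistribLattice

variable [DistribLattice A] [BoundedOrder A] [CompletelyDistribLattice C]
  {e : BoundedLatticeHom A C} {l : Filter ι} {F G : ι → C} {c d : C} {f : A → A}

theorem IsClosedLimit.isClosedElt (he : IsCanonicalExtension e) (hF : IsClosedLimit e l F c) :
    IsClosedElt e c := by
  refine ⟨{a | c ≤ e a}, le_antisymm (le_sInf ?_) (he.le_of_forall_isOpenElt fun u hu hcu => ?_)⟩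
  · rintro _ ⟨a, ha, rfl⟩
    exact ha
  · obtain ⟨a, hca, hau, -⟩ := hF u hu hcu
    exact sInf_le_of_le ⟨a, hca, rfl⟩ hau

theorem IsOpenLimit.isOpenElt (he : IsCanonicalExtension e) (hF : IsOpenLimit e l F c) :
    IsOpenElt e c :=
  IsClosedLimit.isClosedElt he.dual hF

theorem IsClosedLimit.eventually_le (he : IsCanonicalExtension e) (hF : IsClosedLimit e l F c)
    (hG : IsOpenLimit e l G d) (h : c ≤ d) : ∀ᶠ i in l, F i ≤ G i := by
  obtain ⟨a, -, had, ha⟩ := hF d (hG.isOpenElt he) h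
  filter_upwards [ha, hG.eventually_map_le had] with i hFi hGi using hFi.trans hGi

theorem IsClosedElt.isClosedLimit_const (he : IsCanonicalExtension e) (hc : IsClosedElt e c) :
    IsClosedLimit e l (fun _ => c) c := fun _ hu hcu => by
  obtain ⟨a, hca, hau⟩ := he.exists_between hc hu hcu
  exact ⟨a, hca, hau, .of_forall fun _ => hca⟩

theorem IsOpenElt.isOpenLimit_const (he : IsCanonicalExtension e) (hc : IsOpenElt e c) :
    IsOpenLimit e l (fun _ => c) c :=
  IsClosedElt.isClosedLimit_const he.dual hc

theorem IsClosedElt.isClosedLimit_atBot (he : IsCanonicalExtension e) (hc : IsClosedElt e c) :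
    IsClosedLimit e Filter.atBot (fun a : {a // c ≤ e a} => e a) c := fun _ hu hcu => by
  obtain ⟨a, hca, hau⟩ := he.exists_between hc hu hcu
  exact ⟨a, hca, hau,
    (Filter.eventually_le_atBot ⟨a, hca⟩).mono fun _ hb => OrderHomClass.mono e hb⟩

theorem IsOpenElt.isOpenLimit_atTop (he : IsCanonicalExtension e) (hc : IsOpenElt e c) :
    IsOpenLimit e Filter.atTop (fun a : {a // e a ≤ c} => e a) c := fun _ hk hkc => by
  obtain ⟨a, hka, hac⟩ := he.exists_between hk hc hkc
  exact ⟨a, hac, hka,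
    (Filter.eventually_ge_atTop ⟨a, hac⟩).mono fun _ hb => OrderHomClass.mono e hb⟩

theorem IsClosedLimit.inf (he : IsCanonicalExtension e) (hF : IsClosedLimit e l F c)
    (hG : IsClosedLimit e l G d) : IsClosedLimit e l (fun i => F i ⊓ G i) (c ⊓ d) :=
  fun u hu h => by
  obtain ⟨a, b, hca, hdb, hab⟩ :=
    he.exists_map_inf_le (hF.isClosedElt he) (hG.isClosedElt he) hu h
  refine ⟨a ⊓ b, (inf_le_inf hca hdb).trans_eq (map_inf e a b).symm, hab, ?_⟩
  filter_upwards [hF.eventually_le_map hca, hG.eventually_le_map hdb] with i hi hi'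
  exact (inf_le_inf hi hi').trans_eq (map_inf e a b).symm

theorem IsOpenLimit.sup (he : IsCanonicalExtension e) (hF : IsOpenLimit e l F c)
    (hG : IsOpenLimit e l G d) : IsOpenLimit e l (fun i => F i ⊔ G i) (c ⊔ d) :=
  IsClosedLimit.inf he.dual hF hG

theorem IsClosedLimit.sigmaExt (he : IsCanonicalExtension e) (hf : Monotone f)
    (hF : IsClosedLimit e l F c) :
    IsClosedLimit e l (fun i => sigmaExt e f (F i)) (sigmaExt e f c) := fun u hu h => by
  have hle {d : C} {a : A} (hd : d ≤ e a) : MuALBA.sigmaExt e f d ≤ e (f a) :=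
    (he.sigmaExt_mono hf hd).trans_eq (he.sigmaExt_map hf a)
  obtain ⟨a, hca, hau⟩ := (he.sigmaExt_le_iff_of_isClosedElt hf (hF.isClosedElt he) hu).1 h
  exact ⟨f a, hle hca, hau, (hF.eventually_le_map hca).mono fun i => hle⟩

theorem IsOpenLimit.sigmaExt (he : IsCanonicalExtension e) (hf : Monotone f)
    (hF : IsOpenLimit e l F c) :
    IsOpenLimit e l (fun i => sigmaExt e f (F i)) (sigmaExt e f c) := fun k hk h => by
  have hle {d : C} {a : A} (hd : e a ≤ d) : e (f a) ≤ MuALBA.sigmaExt e f d :=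
    (he.sigmaExt_map hf a).symm.trans_le (he.sigmaExt_mono hf hd)
  obtain ⟨a, hac, hka⟩ := he.exists_le_map_of_le_sigmaExt hf (hF.isOpenElt he) hk h
  exact ⟨f a, hle hac, hka, (hF.eventually_map_le hac).mono fun i => hle⟩

theorem IsClosedLimit.piExt (he : IsCanonicalExtension e) (hf : Monotone f)
    (hF : IsClosedLimit e l F c) :
    IsClosedLimit e l (fun i => piExt e f (F i)) (piExt e f c) := by
  simp only [piExt_eq_sigmaExt_dual]
  exact IsOpenLimit.sigmaExt he.dual hf.dual hF

theorem IsOpenLimit.piExt (he : IsCanonicalExtension e) (hf : Monotone f)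
    (hF : IsOpenLimit e l F c) :
    IsOpenLimit e l (fun i => piExt e f (F i)) (piExt e f c) := by
  simp only [piExt_eq_sigmaExt_dual]
  exact IsClosedLimit.sigmaExt he.dual hf.dual hF

theorem IsOpenLimit.rightAdjoint_sigmaExt (he : IsCanonicalExtension e) (hf : Monotone f)
    {g : C → C} (hg : GaloisConnection (MuALBA.sigmaExt e f) g) (hF : IsOpenLimit e l F c) :
    IsOpenLimit e l (fun i => g (F i)) (g c) := fun k hk h => by
  have hle {d : C} {a : A} (hd : e (f a) ≤ d) : e a ≤ g d :=
    (hg _ _).1 ((he.sigmaExt_map hf a).trans_le hd)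
  obtain ⟨a, hka, hac⟩ :=
    (he.sigmaExt_le_iff_of_isClosedElt hf hk (hF.isOpenElt he)).1 ((hg k c).2 h)
  exact ⟨a, hle hac, hka, (hF.eventually_map_le hac).mono fun i => hle⟩

theorem IsClosedLimit.leftAdjoint_piExt (he : IsCanonicalExtension e) (hf : Monotone f)
    {g : C → C} (hg : GaloisConnection g (MuALBA.piExt e f)) (hF : IsClosedLimit e l F c) :
    IsClosedLimit e l (fun i => g (F i)) (g c) := by
  simp only [GaloisConnection, piExt_eq_sigmaExt_dual] at hg
  exact IsOpenLimit.rightAdjoint_sigmaExt he.dual hf.dual (fun a b => (hg b a).symm) hF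

theorem IsClosedLimit.sInf_prefixed (he : IsCanonicalExtension e) {F : A → ι → C} {c : A → C}
    (hF : ∀ a, IsClosedLimit e l (F a) (c a)) :
    IsClosedLimit e l (fun i => sInf (e '' {a | F a i ≤ e a})) (sInf (e '' {a | c a ≤ e a})) := by
  rintro _ ⟨T, rfl⟩ h
  obtain ⟨S', T', hS', hT', hST⟩ := he.compact _ T h
  have hmap : e (S'.inf id) = S'.inf e := map_finset_inf e S' id
  refine ⟨S'.inf id, ?_, ?_, ?_⟩ <;> rw [hmap]
  · exact Finset.le_inf fun a ha => sInf_le ⟨a, hS' ha, rfl⟩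
  · exact hST.trans (Finset.sup_le fun b hb => le_sSup ⟨b, hT' hb, rfl⟩)
  · have hprefixed : ∀ᶠ i in l, ∀ a ∈ S', F a i ≤ e a :=
      (Filter.eventually_all_finset S').2 fun a ha => (hF a).eventually_le_map (hS' ha)
    exact hprefixed.mono fun i hi => Finset.le_inf fun a ha => sInf_le ⟨a, hi a ha, rfl⟩

theorem IsOpenLimit.sSup_postfixed (he : IsCanonicalExtension e) {F : A → ι → C} {c : A → C}
    (hF : ∀ a, IsOpenLimit e l (F a) (c a)) :
    IsOpenLimit e l (fun i => sSup (e '' {a | e a ≤ F a i})) (sSup (e '' {a | e a ≤ c a})) :=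
  IsClosedLimit.sInf_prefixed he.dual hF

end DistribLattice

section Heyting

variable [HeytingAlgebra A] [CompletelyDistribLattice C] {e : BoundedLatticeHom A C}
  {l : Filter ι} {F G : ι → C} {c d : C}

theorem IsClosedLimit.himp (he : IsCanonicalExtension e) (hF : IsOpenLimit e l F c)
    (hG : IsClosedLimit e l G d) : IsClosedLimit e l (fun i => F i ⇨ G i) (c ⇨ d) :=
  fun u hu h => by
  obtain ⟨a, b, hac, hdb, hab⟩ :=
    he.exists_map_himp_le (hF.isOpenElt he) (hG.isClosedElt he) hu h
  refine ⟨a ⇨ b, (himp_le_himp hac hdb).trans_eq (he.map_himp a b).symm, hab, ?_⟩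
  filter_upwards [hF.eventually_map_le hac, hG.eventually_le_map hdb] with i hi hi'
  exact (himp_le_himp hi hi').trans_eq (he.map_himp a b).symm

theorem IsOpenLimit.himp (he : IsCanonicalExtension e) (hF : IsClosedLimit e l F c)
    (hG : IsOpenLimit e l G d) : IsOpenLimit e l (fun i => F i ⇨ G i) (c ⇨ d) :=
  fun k hk h => by
  obtain ⟨a, b, hca, hbd, hab⟩ :=
    he.exists_le_map_himp (hF.isClosedElt he) (hG.isOpenElt he) hk h
  refine ⟨a ⇨ b, (he.map_himp a b).trans_le (himp_le_himp hca hbd), hab, ?_⟩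
  filter_upwards [hF.eventually_le_map hca, hG.eventually_map_le hbd] with i hi hi'
  exact (he.map_himp a b).trans_le (himp_le_himp hi hi')

end Heyting

section Coheyting

variable [CoheytingAlgebra A] [CompletelyDistribLattice C] {e : BoundedLatticeHom A C}
  {l : Filter ι} {F G : ι → C} {c d : C}

theorem IsClosedLimit.sdiff (he : IsCanonicalExtension e) (hF : IsClosedLimit e l F c)
    (hG : IsOpenLimit e l G d) : IsClosedLimit e l (fun i => F i \ G i) (c \ d) :=
  IsOpenLimit.himp (A := Aᵒᵈ) he.dual hG hF

theorem IsOpenLimit.sdiff (he : IsCanonicalExtension e) (hF : IsOpenLimit e l F c)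
    (hG : IsClosedLimit e l G d) : IsOpenLimit e l (fun i => F i \ G i) (c \ d) :=
  IsClosedLimit.himp (A := Aᵒᵈ) he.dual hG hF

end Coheyting

end Limit

/-! ## Limits of syntactically closed and open formulas -/

section EvalLimit

/-- `IsClosedLimit` for `false` and `IsOpenLimit` for `true`, matching the encoding of
`Form.SynOC`. -/
def IsLimit {A : Type u} {C : Type v} {ι : Type*} [CompleteLattice C] (e : A → C) (l : Filter ι)
    (b : Bool) (F : ι → C) (c : C) : Prop :=
  if b then IsOpenLimit e l F c else IsClosedLimit e l F c

variable {A : Type u} {C : Type v} [ModalBiHeyting A] [CompletelyDistribLattice C]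
  {e : BoundedLatticeHom A C} {ι : Type*} {l : Filter ι} {b : Bool} {F G : ι → C} {c d : C}

theorem isLimit_const_map (he : IsCanonicalExtension e) (a : A) :
    IsLimit e l b (fun _ => e a) (e a) := by
  cases b
  exacts [(isClosedElt_map a).isClosedLimit_const he, (isOpenElt_map a).isOpenLimit_const he]

theorem IsLimit.inf (he : IsCanonicalExtension e) (hF : IsLimit e l b F c)
    (hG : IsLimit e l b G d) : IsLimit e l b (fun i => F i ⊓ G i) (c ⊓ d) := by
  cases b
  exacts [IsClosedLimit.inf he hF hG, IsOpenLimit.inf hF hG]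

theorem IsLimit.sup (he : IsCanonicalExtension e) (hF : IsLimit e l b F c)
    (hG : IsLimit e l b G d) : IsLimit e l b (fun i => F i ⊔ G i) (c ⊔ d) := by
  cases b
  exacts [IsClosedLimit.sup hF hG, IsOpenLimit.sup he hF hG]

theorem IsLimit.himp (he : IsCanonicalExtension e) (hF : IsLimit e l (!b) F c)
    (hG : IsLimit e l b G d) : IsLimit e l b (fun i => F i ⇨ G i) (c ⇨ d) := by
  cases b
  exacts [IsClosedLimit.himp he hF hG, IsOpenLimit.himp he hF hG]

theorem IsLimit.sdiff (he : IsCanonicalExtension e) (hF : IsLimit e l b F c)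
    (hG : IsLimit e l (!b) G d) : IsLimit e l b (fun i => F i \ G i) (c \ d) := by
  cases b
  exacts [IsClosedLimit.sdiff he hF hG, IsOpenLimit.sdiff he hF hG]

theorem IsLimit.diaExt (he : IsCanonicalExtension e) (hF : IsLimit e l b F c) :
    IsLimit e l b (fun i => diaExt e (F i)) (diaExt e c) := by
  cases b
  exacts [IsClosedLimit.sigmaExt he dia_mono hF, IsOpenLimit.sigmaExt he dia_mono hF]

theorem IsLimit.boxExt (he : IsCanonicalExtension e) (hF : IsLimit e l b F c) :
    IsLimit e l b (fun i => boxExt e (F i)) (boxExt e c) := by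
  cases b
  exacts [IsClosedLimit.piExt he box_mono hF, IsOpenLimit.piExt he box_mono hF]

/-- A limit of kind `b'` at `p` is only needed if `p` occurs with the sign opposite to `b ^^ b'`. -/
theorem isLimit_eval (he : IsCanonicalExtension e) {v : ι → ℕ → C} {w : ℕ → C}
    (V : Assignment C) {φ : Form} (ρ : ℕ → A) (hφ : φ.SynOC b)
    (hv : ∀ p b', IsLimit e l b' (v · p) (w p) ∨ φ.PropSign p (b ^^ b')) :
    IsLimit e l b (fun i => eval e {V with prop := v i} φ (e ∘ ρ))
      (eval e {V with prop := w} φ (e ∘ ρ)) := by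
  induction φ generalizing ρ b with
  | bot => simpa only [eval, map_bot] using isLimit_const_map he ⊥
  | top => simpa only [eval, map_top] using isLimit_const_map he ⊤
  | prop p => exact (hv p b).resolve_right fun h => by simp [Form.PropSign] at h
  | fvar X => exact isLimit_const_map he (ρ X)
  | nom j =>
    obtain rfl : b = false := hφ
    exact (he.isClosedElt_of_isCJI (V.nom_cji j)).isClosedLimit_const he
  | cnom m =>
    obtain rfl : b = true := hφ
    exact (he.isOpenElt_of_isCMI (V.cnom_cmi m)).isOpenLimit_const he
  | and φ ψ ihφ ihψ =>
    exact (ihφ ρ hφ.1 fun p b' => (hv p b').imp_right And.left).inf he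
      (ihψ ρ hφ.2 fun p b' => (hv p b').imp_right And.right)
  | or φ ψ ihφ ihψ =>
    exact (ihφ ρ hφ.1 fun p b' => (hv p b').imp_right And.left).sup he
      (ihψ ρ hφ.2 fun p b' => (hv p b').imp_right And.right)
  | imp φ ψ ihφ ihψ =>
    exact (ihφ ρ hφ.1 fun p b' => Bool.not_xor b b' ▸ (hv p b').imp_right And.left).himp he
      (ihψ ρ hφ.2 fun p b' => (hv p b').imp_right And.right)
  | sub φ ψ ihφ ihψ =>
    exact (ihφ ρ hφ.1 fun p b' => (hv p b').imp_right And.left).sdiff he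
      (ihψ ρ hφ.2 fun p b' => Bool.not_xor b b' ▸ (hv p b').imp_right And.right)
  | dia φ ih => exact (ih ρ hφ hv).diaExt he
  | box φ ih => exact (ih ρ hφ hv).boxExt he
  | bbox φ ih =>
    obtain ⟨rfl, hφ⟩ := hφ
    exact IsOpenLimit.rightAdjoint_sigmaExt he dia_mono he.gc_diaExt_bboxExt (ih ρ hφ hv)
  | bdia φ ih =>
    obtain ⟨rfl, hφ⟩ := hφ
    exact IsClosedLimit.leftAdjoint_piExt he box_mono he.gc_bdiaExt_boxExt (ih ρ hφ hv)
  | mu | nu => exact hφ.elim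
  | muS X φ ih =>
    obtain ⟨rfl, hφ⟩ := hφ
    exact IsClosedLimit.sInf_prefixed he fun a =>
      Function.comp_update e ρ X a ▸ ih (Function.update ρ X a) hφ hv
  | nuS X φ ih =>
    obtain ⟨rfl, hφ⟩ := hφ
    exact IsOpenLimit.sSup_postfixed he fun a =>
      Function.comp_update e ρ X a ▸ ih (Function.update ρ X a) hφ hv

end EvalLimit

/-! ## Formulas -/

namespace Form

@[simp] theorem noms_star (φ : Form) : φ.star.noms = φ.noms := by
  induction φ <;> simp_all [star, noms]

@[simp] theorem cnoms_star (φ : Form) : φ.star.cnoms = φ.cnoms := by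
  induction φ <;> simp_all [star, cnoms]

@[simp] theorem freeVars_star (φ : Form) : φ.star.freeVars = φ.freeVars := by
  induction φ <;> simp_all [star, freeVars]

@[simp] theorem isSentence_star {φ : Form} : φ.star.IsSentence ↔ φ.IsSentence := by
  rw [IsSentence, freeVars_star, IsSentence]

@[simp] theorem propSign_star {p : ℕ} {s : Bool} {φ : Form} :
    PropSign p s φ.star ↔ PropSign p s φ := by
  induction φ generalizing s <;> simp_all [star, PropSign, -Bool.forall_bool]

@[simp] theorem varSign_star {X : ℕ} {s : Bool} {φ : Form} :
    VarSign X s φ.star ↔ VarSign X s φ := by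
  induction φ generalizing s <;> simp_all [star, VarSign, -Bool.forall_bool]

theorem star_subst (p : ℕ) (α φ : Form) : (subst p α φ).star = subst p α.star φ.star := by
  induction φ with
  | prop q => by_cases h : q = p <;> simp [subst, star, h]
  | _ => simp_all [subst, star]

theorem freeVars_subst_subset (p : ℕ) (α φ : Form) :
    (subst p α φ).freeVars ⊆ α.freeVars ∪ φ.freeVars := by
  induction φ with
  | prop q => by_cases h : q = p <;> simp [subst, freeVars, h]
  | _ => simp only [subst, freeVars] at *; grind

theorem noms_subst_subset (p : ℕ) (α φ : Form) : (subst p α φ).noms ⊆ α.noms ∪ φ.noms := by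
  induction φ with
  | prop q => by_cases h : q = p <;> simp [subst, noms, h]
  | _ => simp only [subst, noms] at *; grind

theorem cnoms_subst_subset (p : ℕ) (α φ : Form) : (subst p α φ).cnoms ⊆ α.cnoms ∪ φ.cnoms := by
  induction φ with
  | prop q => by_cases h : q = p <;> simp [subst, cnoms, h]
  | _ => simp only [subst, cnoms] at *; grind

theorem IsSentence.subst {α φ : Form} (hφ : φ.IsSentence) (hα : α.IsSentence) (p : ℕ) :
    (subst p α φ).IsSentence := by
  have h := freeVars_subst_subset p α φ
  rwa [hα, hφ, Finset.empty_union, Finset.subset_empty] at h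

/-- The sentences without nominals and co-nominals. -/
structure IsPlain (φ : Form) : Prop where
  isSentence : φ.IsSentence
  noms_eq : φ.noms = ∅
  cnoms_eq : φ.cnoms = ∅

theorem IsL1.isPlain {φ : Form} (h : φ.IsL1) (hs : φ.IsSentence) : φ.IsPlain := by
  refine ⟨hs, ?_, ?_⟩ <;> clear hs <;> induction φ <;> simp_all [IsL1, noms, cnoms]

theorem isPlain_bot : bot.IsPlain := ⟨rfl, rfl, rfl⟩

theorem isPlain_top : top.IsPlain := ⟨rfl, rfl, rfl⟩

theorem IsPlain.subst {α φ : Form} (hφ : φ.IsPlain) (hα : α.IsPlain) (p : ℕ) :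
    (subst p α φ).IsPlain := by
  have hnoms := noms_subst_subset p α φ
  have hcnoms := cnoms_subst_subset p α φ
  rw [hα.noms_eq, hφ.noms_eq, Finset.empty_union, Finset.subset_empty] at hnoms
  rw [hα.cnoms_eq, hφ.cnoms_eq, Finset.empty_union, Finset.subset_empty] at hcnoms
  exact ⟨hφ.isSentence.subst hα.isSentence p, hnoms, hcnoms⟩

theorem isPlain_or {φ ψ : Form} : (or φ ψ).IsPlain ↔ φ.IsPlain ∧ ψ.IsPlain := by
  refine ⟨fun ⟨hs, hn, hc⟩ => ?_, fun ⟨hφ, hψ⟩ => ?_⟩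
  · rw [IsSentence, freeVars, Finset.union_eq_empty] at hs
    rw [noms, Finset.union_eq_empty] at hn
    rw [cnoms, Finset.union_eq_empty] at hc
    exact ⟨⟨hs.1, hn.1, hc.1⟩, ⟨hs.2, hn.2, hc.2⟩⟩
  · exact ⟨Finset.union_eq_empty.2 ⟨hφ.1, hψ.1⟩, Finset.union_eq_empty.2 ⟨hφ.2, hψ.2⟩,
      Finset.union_eq_empty.2 ⟨hφ.3, hψ.3⟩⟩

theorem isPlain_and {φ ψ : Form} : (and φ ψ).IsPlain ↔ φ.IsPlain ∧ ψ.IsPlain := by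
  refine ⟨fun ⟨hs, hn, hc⟩ => ?_, fun ⟨hφ, hψ⟩ => ?_⟩
  · rw [IsSentence, freeVars, Finset.union_eq_empty] at hs
    rw [noms, Finset.union_eq_empty] at hn
    rw [cnoms, Finset.union_eq_empty] at hc
    exact ⟨⟨hs.1, hn.1, hc.1⟩, ⟨hs.2, hn.2, hc.2⟩⟩
  · exact ⟨Finset.union_eq_empty.2 ⟨hφ.1, hψ.1⟩, Finset.union_eq_empty.2 ⟨hφ.2, hψ.2⟩,
      Finset.union_eq_empty.2 ⟨hφ.3, hψ.3⟩⟩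

theorem isSentence_bigOr {l : List Form} (h : ∀ α ∈ l, α.IsSentence) : (bigOr l).IsSentence := by
  induction l using bigOr.induct with
  | case1 => rfl
  | case2 α => exact h α (List.mem_singleton_self α)
  | case3 α β l ih =>
    rw [List.forall_mem_cons] at h
    exact Finset.union_eq_empty.2 ⟨h.1, ih h.2⟩

theorem isSentence_bigAnd {l : List Form} (h : ∀ α ∈ l, α.IsSentence) :
    (bigAnd l).IsSentence := by
  induction l using bigAnd.induct with
  | case1 => rfl
  | case2 α => exact h α (List.mem_singleton_self α)
  | case3 α β l ih =>
    rw [List.forall_mem_cons] at h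
    exact Finset.union_eq_empty.2 ⟨h.1, ih h.2⟩

theorem synOC_bigOr {b : Bool} {l : List Form} (h : ∀ α ∈ l, α.SynOC b) : (bigOr l).SynOC b := by
  induction l using bigOr.induct with
  | case1 => trivial
  | case2 α => exact h α (List.mem_singleton_self α)
  | case3 α β l ih =>
    rw [List.forall_mem_cons] at h
    exact ⟨h.1, ih h.2⟩

theorem synOC_bigAnd {b : Bool} {l : List Form} (h : ∀ α ∈ l, α.SynOC b) :
    (bigAnd l).SynOC b := by
  induction l using bigAnd.induct with
  | case1 => trivial
  | case2 α => exact h α (List.mem_singleton_self α)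
  | case3 α β l ih =>
    rw [List.forall_mem_cons] at h
    exact ⟨h.1, ih h.2⟩

end Form

/-! ## Assignments and the value of a formula -/

namespace Assignment

variable {A : Type u} {C : Type v} [CompleteLattice C]

/-- The assignment `V` with the value of the propositional variable `p` changed to `c`. -/
def setProp (V : Assignment C) (p : ℕ) (c : C) : Assignment C :=
  { V with prop := Function.update V.prop p c }

/-- The assignment `V` with the value of the nominal `j` changed to `c`. -/
def setNom (V : Assignment C) (j : ℕ) (c : C) (hc : IsCJI c) : Assignment C :=
  { V with
    nom := Function.update V.nom j c
    nom_cji := (Function.forall_update_iff V.nom fun _ => IsCJI).2 ⟨hc, fun i _ => V.nom_cji i⟩ }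

/-- The assignment `V` with the value of the co-nominal `m` changed to `c`. -/
def setCnom (V : Assignment C) (m : ℕ) (c : C) (hc : IsCMI c) : Assignment C :=
  { V with
    cnom := Function.update V.cnom m c
    cnom_cmi :=
      (Function.forall_update_iff V.cnom fun _ => IsCMI).2 ⟨hc, fun i _ => V.cnom_cmi i⟩ }

@[simp] theorem setProp_self (V : Assignment C) (p : ℕ) : V.setProp p (V.prop p) = V := by
  rw [setProp, Function.update_eq_self]

/-- The admissible assignments: propositional variables take their values in `A`, while nominals and
co-nominals are not restricted. -/
def IsAdmissible (e : A → C) (V : Assignment C) : Prop := ∃ v : ℕ → A, V.prop = e ∘ v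

theorem IsAdmissible.setProp {e : A → C} {V : Assignment C} (hV : V.IsAdmissible e) (p : ℕ)
    (a : A) : (V.setProp p (e a)).IsAdmissible e := by
  obtain ⟨v, hv⟩ := hV
  exact ⟨Function.update v p a, by rw [Function.comp_update, ← hv]; rfl⟩

end Assignment

section Eval

variable {A : Type u} {C : Type v} [ModalBiHeyting A] [CompletelyDistribLattice C] {e : A → C}
  {V W : Assignment C} {φ : Form} {ρ σ : ℕ → C}

theorem eval_congr (hprop : ∀ p ∈ φ.props, V.prop p = W.prop p)
    (hnom : ∀ j ∈ φ.noms, V.nom j = W.nom j) (hcnom : ∀ m ∈ φ.cnoms, V.cnom m = W.cnom m)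
    (hvar : ∀ X ∈ φ.freeVars, ρ X = σ X) : eval e V φ ρ = eval e W φ σ := by
  induction φ generalizing ρ σ with
  | bot | top => rfl
  | prop p => exact hprop p (Finset.mem_singleton_self p)
  | fvar X => exact hvar X (Finset.mem_singleton_self X)
  | nom j => exact hnom j (Finset.mem_singleton_self j)
  | cnom m => exact hcnom m (Finset.mem_singleton_self m)
  | and φ ψ ihφ ihψ | or φ ψ ihφ ihψ | imp φ ψ ihφ ihψ | sub φ ψ ihφ ihψ =>
    simp only [Form.props, Form.noms, Form.cnoms, Form.freeVars, Finset.forall_mem_union]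
      at hprop hnom hcnom hvar
    simp only [eval, ihφ hprop.1 hnom.1 hcnom.1 hvar.1, ihψ hprop.2 hnom.2 hcnom.2 hvar.2]
  | dia φ ih | box φ ih | bbox φ ih | bdia φ ih => simp only [eval, ih hprop hnom hcnom hvar]
  | mu X φ ih | nu X φ ih | muS X φ ih | nuS X φ ih =>
    have hbody (c : C) :
        eval e V φ (Function.update ρ X c) = eval e W φ (Function.update σ X c) :=
      ih hprop hnom hcnom fun Y hY => by
        rcases eq_or_ne Y X with rfl | hYX
        · simp only [Function.update_self]
        · simpa only [Function.update_of_ne hYX] using hvar Y (Finset.mem_erase.2 ⟨hYX, hY⟩)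
    simp only [eval, hbody]

theorem eval_eq_of_isSentence (h : φ.IsSentence) (ρ σ : ℕ → C) : eval e V φ ρ = eval e V φ σ :=
  eval_congr (fun _ _ => rfl) (fun _ _ => rfl) (fun _ _ => rfl)
    fun _ hX => absurd hX (Finset.eq_empty_iff_forall_notMem.1 h _)

theorem eval_setProp_of_notMem {p : ℕ} (h : p ∉ φ.props) (c : C) :
    eval e (V.setProp p c) φ ρ = eval e V φ ρ :=
  eval_congr (fun _ hq => Function.update_of_ne (ne_of_mem_of_not_mem hq h) _ _)
    (fun _ _ => rfl) (fun _ _ => rfl) (fun _ _ => rfl)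

theorem eval_setNom_of_notMem {j : ℕ} (h : j ∉ φ.noms) {c : C} (hc : IsCJI c) :
    eval e (V.setNom j c hc) φ ρ = eval e V φ ρ :=
  eval_congr (fun _ _ => rfl) (fun _ hi => Function.update_of_ne (ne_of_mem_of_not_mem hi h) _ _)
    (fun _ _ => rfl) (fun _ _ => rfl)

theorem eval_setCnom_of_notMem {m : ℕ} (h : m ∉ φ.cnoms) {c : C} (hc : IsCMI c) :
    eval e (V.setCnom m c hc) φ ρ = eval e V φ ρ :=
  eval_congr (fun _ _ => rfl) (fun _ _ => rfl)
    (fun _ hn => Function.update_of_ne (ne_of_mem_of_not_mem hn h) _ _) (fun _ _ => rfl)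

theorem eval_subst {α : Form} (hα : α.IsSentence) (p : ℕ) (φ : Form) (ρ σ : ℕ → C) :
    eval e V (Form.subst p α φ) ρ = eval e (V.setProp p (eval e V α σ)) φ ρ := by
  induction φ generalizing ρ with
  | prop q =>
    rcases eq_or_ne q p with rfl | hq
    · simpa [Form.subst, eval, Assignment.setProp] using eval_eq_of_isSentence hα ρ σ
    · simp [Form.subst, eval, Assignment.setProp, hq]
  | _ => simp_all [Form.subst, eval, Assignment.setProp]

theorem eval_bigOr_le_iff {l : List Form} {c : C} :
    eval e V (Form.bigOr l) ρ ≤ c ↔ ∀ α ∈ l, eval e V α ρ ≤ c := by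
  induction l using Form.bigOr.induct with
  | case1 => simp [Form.bigOr, eval]
  | case2 => simp [Form.bigOr]
  | case3 α β l ih => rw [List.forall_mem_cons, ← ih]; exact sup_le_iff

theorem le_eval_bigAnd_iff {l : List Form} {c : C} :
    c ≤ eval e V (Form.bigAnd l) ρ ↔ ∀ α ∈ l, c ≤ eval e V α ρ := by
  induction l using Form.bigAnd.induct with
  | case1 => simp [Form.bigAnd, eval]
  | case2 => simp [Form.bigAnd]
  | case3 α β l ih => rw [List.forall_mem_cons, ← ih]; exact le_inf_iff

end Eval

/-! ## Monotonicity -/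

/-- Monotone maps for `s = true` and antitone maps for `s = false`, matching the signs in
`Form.PropSign` and `Form.VarSign`. -/
def SignedMonotone {P D : Type*} [Preorder P] [Preorder D] (s : Bool) (f : P → D) : Prop :=
  if s then Monotone f else Antitone f

namespace SignedMonotone

variable {P D E : Type*} [Preorder P] {s : Bool}

theorem const [Preorder D] (d : D) : SignedMonotone s fun _ : P => d := by
  cases s
  exacts [antitone_const, monotone_const]

theorem id : SignedMonotone true fun x : P => x := monotone_id

theorem inf [SemilatticeInf D] {f g : P → D} (hf : SignedMonotone s f)
    (hg : SignedMonotone s g) : SignedMonotone s fun x => f x ⊓ g x := by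
  cases s
  exacts [Antitone.inf hf hg, Monotone.inf hf hg]

theorem sup [SemilatticeSup D] {f g : P → D} (hf : SignedMonotone s f)
    (hg : SignedMonotone s g) : SignedMonotone s fun x => f x ⊔ g x := by
  cases s
  exacts [Antitone.sup hf hg, Monotone.sup hf hg]

theorem himp [GeneralizedHeytingAlgebra D] {f g : P → D} (hf : SignedMonotone (!s) f)
    (hg : SignedMonotone s g) : SignedMonotone s fun x => f x ⇨ g x := by
  cases s <;> exact fun x y hxy => himp_le_himp (hf hxy) (hg hxy)

theorem sdiff [GeneralizedCoheytingAlgebra D] {f g : P → D} (hf : SignedMonotone s f)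
    (hg : SignedMonotone (!s) g) : SignedMonotone s fun x => f x \ g x := by
  cases s <;> exact fun x y hxy => sdiff_le_sdiff (hf hxy) (hg hxy)

theorem comp [Preorder D] [Preorder E] {f : P → D} {g : D → E} (hg : Monotone g)
    (hf : SignedMonotone s f) : SignedMonotone s fun x => g (f x) := by
  cases s
  exacts [hg.comp_antitone hf, hg.comp hf]

theorem sInf_prefixed {S : Type*} [CompleteLattice D] (g : S → D) {f : S → P → D}
    (hf : ∀ a, SignedMonotone s (f a)) :
    SignedMonotone s fun x => sInf (g '' {a | f a x ≤ g a}) := by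
  cases s <;>
    exact fun x y hxy => sInf_le_sInf (Set.image_mono fun a ha => (hf a hxy).trans ha)

theorem sSup_postfixed {S : Type*} [CompleteLattice D] (g : S → D) {f : S → P → D}
    (hf : ∀ a, SignedMonotone s (f a)) :
    SignedMonotone s fun x => sSup (g '' {a | g a ≤ f a x}) := by
  cases s <;>
    exact fun x y hxy => sSup_le_sSup (Set.image_mono fun a ha => le_trans ha (hf a hxy))

end SignedMonotone

section Monotonicity

variable {A : Type u} {C : Type v} [ModalBiHeyting A] [CompletelyDistribLattice C]
  {e : BoundedLatticeHom A C} {P : Type*} [Preorder P] {s : Bool} {φ : Form}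

theorem signedMonotone_update {X Y : ℕ} {ρ : P → ℕ → C} {c : C} {s' : Bool}
    (h : SignedMonotone s' (ρ · Y) ∨ X = Y ∨ φ.VarSign Y s) :
    SignedMonotone s' (fun x => Function.update (ρ x) X c Y) ∨ φ.VarSign Y s := by
  rcases eq_or_ne Y X with rfl | hYX
  · simpa only [Function.update_self] using .inl (.const c)
  · simpa only [Function.update_of_ne hYX, hYX.symm, false_or] using h

theorem signedMonotone_eval (he : IsCanonicalExtension e) {v ρ : P → ℕ → C} (V : Assignment C)
    (hv : ∀ p s', SignedMonotone s' (v · p) ∨ φ.PropSign p (s ^^ s'))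
    (hρ : ∀ X s', SignedMonotone s' (ρ · X) ∨ φ.VarSign X (s ^^ s')) :
    SignedMonotone s fun x => eval e {V with prop := v x} φ (ρ x) := by
  induction φ generalizing ρ s with
  | bot | top | nom j | cnom m => exact .const _
  | prop p => exact (hv p s).resolve_right fun h => by simp [Form.PropSign] at h
  | fvar X => exact (hρ X s).resolve_right fun h => by simp [Form.VarSign] at h
  | and φ ψ ihφ ihψ =>
    exact (ihφ (fun p s' => (hv p s').imp_right And.left)
      fun X s' => (hρ X s').imp_right And.left).inf
      (ihψ (fun p s' => (hv p s').imp_right And.right)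
        fun X s' => (hρ X s').imp_right And.right)
  | or φ ψ ihφ ihψ =>
    exact (ihφ (fun p s' => (hv p s').imp_right And.left)
      fun X s' => (hρ X s').imp_right And.left).sup
      (ihψ (fun p s' => (hv p s').imp_right And.right)
        fun X s' => (hρ X s').imp_right And.right)
  | imp φ ψ ihφ ihψ =>
    exact (ihφ (fun p s' => Bool.not_xor s s' ▸ (hv p s').imp_right And.left)
      fun X s' => Bool.not_xor s s' ▸ (hρ X s').imp_right And.left).himp
      (ihψ (fun p s' => (hv p s').imp_right And.right)
        fun X s' => (hρ X s').imp_right And.right)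
  | sub φ ψ ihφ ihψ =>
    exact (ihφ (fun p s' => (hv p s').imp_right And.left)
      fun X s' => (hρ X s').imp_right And.left).sdiff
      (ihψ (fun p s' => Bool.not_xor s s' ▸ (hv p s').imp_right And.right)
        fun X s' => Bool.not_xor s s' ▸ (hρ X s').imp_right And.right)
  | dia φ ih => exact .comp (he.sigmaExt_mono dia_mono) (ih hv hρ)
  | box φ ih => exact .comp (he.piExt_mono box_mono) (ih hv hρ)
  | bbox φ ih => exact .comp he.gc_diaExt_bboxExt.monotone_u (ih hv hρ)
  | bdia φ ih => exact .comp he.gc_bdiaExt_boxExt.monotone_l (ih hv hρ)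
  | mu X φ ih =>
    have hbody (c : C) := ih hv fun Y s' => signedMonotone_update (c := c) (hρ Y s')
    simpa only [eval, Set.image_id', id] using SignedMonotone.sInf_prefixed id hbody
  | nu X φ ih =>
    have hbody (c : C) := ih hv fun Y s' => signedMonotone_update (c := c) (hρ Y s')
    simpa only [eval, Set.image_id', id] using SignedMonotone.sSup_postfixed id hbody
  | muS X φ ih =>
    exact .sInf_prefixed e fun a => ih hv fun Y s' => signedMonotone_update (hρ Y s')
  | nuS X φ ih =>
    exact .sSup_postfixed e fun a => ih hv fun Y s' => signedMonotone_update (hρ Y s')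

theorem signedMonotone_eval_setProp (he : IsCanonicalExtension e) (V : Assignment C) {p : ℕ}
    (hφ : φ.PropSign p s) (ρ : ℕ → C) :
    SignedMonotone s fun c => eval e (V.setProp p c) φ ρ := by
  refine signedMonotone_eval he V (fun q s' => ?_) fun X s' => .inl (.const (ρ X))
  rcases eq_or_ne q p with rfl | hq
  · cases s'
    · exact .inr ((Bool.xor_false s).symm ▸ hφ)
    · exact .inl (by simpa only [Function.update_self] using .id)
  · exact .inl (by simpa only [Function.update_of_ne hq] using .const _)

theorem monotone_eval_update (he : IsCanonicalExtension e) (V : Assignment C) {X : ℕ}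
    (hφ : φ.VarSign X true) (ρ : ℕ → C) :
    Monotone fun c => eval e V φ (Function.update ρ X c) := by
  refine signedMonotone_eval (s := true) he V (fun q s' => .inl (.const _)) fun Y s' => ?_
  rcases eq_or_ne Y X with rfl | hY
  · cases s'
    · exact .inr hφ
    · exact .inl (by simpa only [Function.update_self] using .id)
  · exact .inl (by simpa only [Function.update_of_ne hY] using .const _)

end Monotonicity

/-! ## Validity in mu-algebras of the first kind -/

theorem isLeast_of_isGLB_prefixed {P : Type*} [Preorder P] {f : P → P} (hf : Monotone f) {a : P}
    (h : IsGLB {b | f b ≤ b} a) : IsLeast {b | f b ≤ b} a :=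
  ⟨h.2 fun _ hb => (hf (h.1 hb)).trans hb, h.1⟩

theorem isGreatest_of_isLUB_postfixed {P : Type*} [Preorder P] {f : P → P} (hf : Monotone f)
    {a : P} (h : IsLUB {b | b ≤ f b} a) : IsGreatest {b | b ≤ f b} a :=
  ⟨h.2 fun _ hb => le_trans hb (hf (h.1 hb)), h.1⟩

section FirstKind

variable {A : Type u} {C : Type v} [ModalBiHeyting A] [CompletelyDistribLattice C]
  {e : BoundedLatticeHom A C} {V : Assignment C} {v : ℕ → A} {φ ψ : Form}

theorem IsFirstKind.exists_monotone_denotes_iff (hA : IsFirstKind A) (he : IsCanonicalExtension e)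
    (hφ : φ.IsL1) {X : ℕ} (hX : φ.VarSign X true)
    (heval : ∀ σ a, Denotes v φ σ a → eval e V φ.star (e ∘ σ) = e a) (ρ : ℕ → A) :
    ∃ f : A → A, Monotone f ∧ (∀ b c, Denotes v φ (Function.update ρ X b) c ↔ c = f b) ∧
      ∀ b, eval e V φ.star (Function.update (e ∘ ρ) X (e b)) = e (f b) := by
  choose f hf using fun b => hA φ hφ v (Function.update ρ X b)
  have hfe (b : A) : eval e V φ.star (Function.update (e ∘ ρ) X (e b)) = e (f b) := by
    rw [← Function.comp_update, heval _ _ (hf b)]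
  refine ⟨f, fun b c hbc => ?_, fun b c => ⟨fun hc => ?_, fun hc => hc ▸ hf b⟩, hfe⟩
  · rw [← he.map_le_map_iff, ← hfe, ← hfe]
    exact monotone_eval_update he V (Form.varSign_star.2 hX) _ (he.map_le_map_iff.2 hbc)
  · exact he.injective ((heval _ _ hc).symm.trans (heval _ _ (hf b)))

theorem IsFirstKind.eval_star_of_denotes (hA : IsFirstKind A) (he : IsCanonicalExtension e)
    (hV : V.prop = e ∘ v) (hφ : φ.IsL1) {ρ : ℕ → A} {a : A} (h : Denotes v φ ρ a) :
    eval e V φ.star (e ∘ ρ) = e a := by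
  induction φ generalizing ρ a with
  | bot => cases h; exact (map_bot e).symm
  | top => cases h; exact (map_top e).symm
  | prop p => cases h; exact congrFun hV p
  | fvar X => cases h; rfl
  | nom | cnom | bbox | bdia | muS | nuS => exact hφ.elim
  | and φ ψ ihφ ihψ =>
    obtain ⟨b, c, hb, hc, rfl⟩ := h
    simp only [Form.star, eval, ihφ hφ.1 hb, ihψ hφ.2 hc, map_inf]
  | or φ ψ ihφ ihψ =>
    obtain ⟨b, c, hb, hc, rfl⟩ := h
    simp only [Form.star, eval, ihφ hφ.1 hb, ihψ hφ.2 hc, map_sup]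
  | imp φ ψ ihφ ihψ =>
    obtain ⟨b, c, hb, hc, rfl⟩ := h
    simp only [Form.star, eval, ihφ hφ.1 hb, ihψ hφ.2 hc, he.map_himp]
  | sub φ ψ ihφ ihψ =>
    obtain ⟨b, c, hb, hc, rfl⟩ := h
    simp only [Form.star, eval, ihφ hφ.1 hb, ihψ hφ.2 hc, he.map_sdiff]
  | dia φ ih =>
    obtain ⟨b, hb, rfl⟩ := h
    simp only [Form.star, eval, ih hφ hb, he.diaExt_map]
  | box φ ih =>
    obtain ⟨b, hb, rfl⟩ := h
    simp only [Form.star, eval, ih hφ hb, he.boxExt_map]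
  | mu X φ ih =>
    obtain ⟨f, hf, hden, heval⟩ :=
      hA.exists_monotone_denotes_iff he hφ.1 hφ.2 (fun _ _ => ih hφ.1) ρ
    simp only [Denotes, hden, exists_eq_left] at h
    simp only [Form.star, eval, heval, he.map_le_map_iff]
    exact ((OrderHomClass.mono e).map_isLeast (isLeast_of_isGLB_prefixed hf h)).isGLB.sInf_eq
  | nu X φ ih =>
    obtain ⟨f, hf, hden, heval⟩ :=
      hA.exists_monotone_denotes_iff he hφ.1 hφ.2 (fun _ _ => ih hφ.1) ρ
    simp only [Denotes, hden, exists_eq_left] at h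
    simp only [Form.star, eval, heval, he.map_le_map_iff]
    exact ((OrderHomClass.mono e).map_isGreatest
      (isGreatest_of_isLUB_postfixed hf h)).isLUB.sSup_eq

theorem IsFirstKind.validIn_iff (hA : IsFirstKind A) (he : IsCanonicalExtension e) (hφ : φ.IsL1)
    (hψ : ψ.IsL1) :
    ValidIn A φ ψ ↔ ∀ V : Assignment C, V.IsAdmissible e → ∀ ρ : ℕ → A,
      eval e V φ.star (e ∘ ρ) ≤ eval e V ψ.star (e ∘ ρ) := by
  constructor
  · rintro h V ⟨v, hv⟩ ρ
    obtain ⟨a, ha⟩ := hA φ hφ v ρ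
    obtain ⟨b, hb⟩ := hA ψ hψ v ρ
    rw [hA.eval_star_of_denotes he hv hφ ha, hA.eval_star_of_denotes he hv hψ hb]
    exact OrderHomClass.mono e (h v ρ a b ha hb)
  · intro h v ρ a b ha hb
    by_contra hab
    obtain ⟨j, m, hj, hm, -⟩ :=
      he.exists_isCJI_isCMI_of_not_le (he.map_le_map_iff.not.2 hab)
    let V : Assignment C := ⟨e ∘ v, fun _ => j, fun _ => m, fun _ => hj, fun _ => hm⟩
    have hV := h V ⟨v, rfl⟩ ρ
    rw [hA.eval_star_of_denotes he rfl hφ ha, hA.eval_star_of_denotes he rfl hψ hb] at hV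
    exact hab (he.map_le_map_iff.1 hV)

end FirstKind

/-! ## Inequalities and quasi-inequalities -/

section Holds

variable {A : Type u} {C : Type v} [ModalBiHeyting A] [CompletelyDistribLattice C]

/-- The inequality `I` holds in the canonical extension under the assignment `V`, where `ρ` assigns
values to the fixed point variables. -/
def Ineq.Holds (e : A → C) (V : Assignment C) (ρ : ℕ → C) (I : Ineq) : Prop :=
  eval e V I.lhs ρ ≤ eval e V I.rhs ρ

/-- The quasi-inequality `Q` fails in the canonical extension under the assignment `V`, where `ρ`
assigns values to the fixed point variables. -/
def QuasiIneq.Fails (e : A → C) (V : Assignment C) (ρ : ℕ → C) (Q : QuasiIneq) : Prop :=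
  (∀ I ∈ Q.ante, I.Holds e V ρ) ∧ ¬ Q.cons.Holds e V ρ

/-- The inequalities between sentences. -/
def Ineq.IsSentence (I : Ineq) : Prop := I.lhs.IsSentence ∧ I.rhs.IsSentence

section Set

variable {e : A → C} {V : Assignment C} {ρ : ℕ → C} {I c : Ineq} {Γ Δ : Multiset Ineq}

theorem QuasiIneq.fails_cons_iff :
    (⟨I ::ₘ Γ, c⟩ : QuasiIneq).Fails e V ρ ↔ I.Holds e V ρ ∧ (⟨Γ, c⟩ : QuasiIneq).Fails e V ρ := by
  simp only [Fails, Multiset.forall_mem_cons, and_assoc]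

theorem QuasiIneq.fails_add_iff :
    (⟨Γ + Δ, c⟩ : QuasiIneq).Fails e V ρ ↔
      (∀ I ∈ Γ, I.Holds e V ρ) ∧ (⟨Δ, c⟩ : QuasiIneq).Fails e V ρ := by
  simp only [Fails, Multiset.mem_add, or_imp, forall_and, and_assoc]

theorem QuasiIneq.nomFresh_cons_iff {j : ℕ} :
    NomFresh j ⟨I ::ₘ Γ, c⟩ ↔ I.NomFree j ∧ NomFresh j ⟨Γ, c⟩ := by
  simp only [NomFresh, Multiset.forall_mem_cons, and_assoc]

theorem QuasiIneq.cnomFresh_cons_iff {m : ℕ} :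
    CnomFresh m ⟨I ::ₘ Γ, c⟩ ↔ I.CnomFree m ∧ CnomFresh m ⟨Γ, c⟩ := by
  simp only [CnomFresh, Multiset.forall_mem_cons, and_assoc]

theorem Ineq.holds_setProp_iff {p : ℕ} (h : I.PropFree p) (d : C) :
    I.Holds e (V.setProp p d) ρ ↔ I.Holds e V ρ := by
  rw [Holds, Holds, eval_setProp_of_notMem h.1, eval_setProp_of_notMem h.2]

theorem Ineq.holds_setNom_iff {j : ℕ} (h : I.NomFree j) {d : C} (hd : IsCJI d) :
    I.Holds e (V.setNom j d hd) ρ ↔ I.Holds e V ρ := by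
  rw [Holds, Holds, eval_setNom_of_notMem h.1, eval_setNom_of_notMem h.2]

theorem Ineq.holds_setCnom_iff {m : ℕ} (h : I.CnomFree m) {d : C} (hd : IsCMI d) :
    I.Holds e (V.setCnom m d hd) ρ ↔ I.Holds e V ρ := by
  rw [Holds, Holds, eval_setCnom_of_notMem h.1, eval_setCnom_of_notMem h.2]

theorem QuasiIneq.fails_setProp_iff {Q : QuasiIneq} {p : ℕ} (h : ∀ I ∈ Q.ante, I.PropFree p)
    (hcons : Q.cons.PropFree p) (d : C) : Q.Fails e (V.setProp p d) ρ ↔ Q.Fails e V ρ :=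
  and_congr (forall₂_congr fun I hI => Ineq.holds_setProp_iff (h I hI) d)
    (Ineq.holds_setProp_iff hcons d).not

theorem QuasiIneq.NomFresh.fails_setNom_iff {Q : QuasiIneq} {j : ℕ} (h : Q.NomFresh j) {d : C}
    (hd : IsCJI d) : Q.Fails e (V.setNom j d hd) ρ ↔ Q.Fails e V ρ :=
  and_congr (forall₂_congr fun I hI => Ineq.holds_setNom_iff (h.1 I hI) hd)
    (Ineq.holds_setNom_iff h.2 hd).not

theorem QuasiIneq.CnomFresh.fails_setCnom_iff {Q : QuasiIneq} {m : ℕ} (h : Q.CnomFresh m) {d : C}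
    (hd : IsCMI d) : Q.Fails e (V.setCnom m d hd) ρ ↔ Q.Fails e V ρ :=
  and_congr (forall₂_congr fun I hI => Ineq.holds_setCnom_iff (h.1 I hI) hd)
    (Ineq.holds_setCnom_iff h.2 hd).not

theorem Ineq.holds_subst_iff {α : Form} (hα : α.IsSentence) {p : ℕ} :
    (I.subst p α).Holds e V ρ ↔ I.Holds e (V.setProp p (eval e V α ρ)) ρ := by
  rw [Holds, Holds, Ineq.subst, eval_subst hα p _ ρ, eval_subst hα p _ ρ]

end Set

theorem Ineq.signedMonotone_holds {e : BoundedLatticeHom A C} (he : IsCanonicalExtension e)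
    (V : Assignment C) {I : Ineq} {p : ℕ} {s : Bool} (hl : I.lhs.PropSign p (!s))
    (hr : I.rhs.PropSign p s) (ρ : ℕ → C) :
    SignedMonotone s fun c => I.Holds e (V.setProp p c) ρ := by
  have hl := signedMonotone_eval_setProp he V hl ρ
  have hr := signedMonotone_eval_setProp he V hr ρ
  cases s <;> exact fun c d hcd h => (hl hcd).trans (le_trans h (hr hcd))

end Holds

/-! ## The Ackermann rules -/

section Ackermann

variable {A : Type u} {C : Type v} [ModalBiHeyting A] [CompletelyDistribLattice C]
  {e : BoundedLatticeHom A C} {V : Assignment C} {ρ : ℕ → A} {p : ℕ}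

theorem isLimit_eval_setProp (he : IsCanonicalExtension e) (hV : V.IsAdmissible e) {ι : Type*}
    {l : Filter ι} {b b' : Bool} {F : ι → C} {c : C} (hF : IsLimit e l b F c) {φ : Form}
    (hφ : φ.SynOC b') (hp : φ.PropSign p (b' ^^ !b)) :
    IsLimit e l b' (fun i => eval e (V.setProp p (F i)) φ (e ∘ ρ))
      (eval e (V.setProp p c) φ (e ∘ ρ)) := by
  refine isLimit_eval he V ρ hφ fun q s => ?_
  obtain ⟨v, hv⟩ := hV
  rcases eq_or_ne q p with rfl | hq
  · simp only [Function.update_self]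
    rcases Bool.eq_or_eq_not s b with rfl | rfl
    exacts [.inl hF, .inr hp]
  · simp only [Function.update_of_ne hq, hv]
    exact .inl (isLimit_const_map he (v q))

theorem Ineq.eventually_holds_setProp (he : IsCanonicalExtension e) (hV : V.IsAdmissible e)
    {ι : Type*} {l : Filter ι} {b : Bool} {F : ι → C} {c : C} (hF : IsLimit e l b F c) {I : Ineq}
    (hl : I.lhs.PropSign p (!b) ∧ I.lhs.SynClosed) (hr : I.rhs.PropSign p b ∧ I.rhs.SynOpen)
    (h : I.Holds e (V.setProp p c) (e ∘ ρ)) :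
    ∀ᶠ i in l, I.Holds e (V.setProp p (F i)) (e ∘ ρ) :=
  IsClosedLimit.eventually_le he
    (isLimit_eval_setProp he hV hF hl.2 (by simpa using hl.1))
    (isLimit_eval_setProp he hV hF hr.2 (by simpa using hr.1)) h

theorem isClosedElt_eval (he : IsCanonicalExtension e) (hV : V.IsAdmissible e) {α : Form}
    (hα : α.SynClosed) : IsClosedElt e (eval e V α (e ∘ ρ)) := by
  obtain ⟨v, hv⟩ := hV
  refine IsClosedLimit.isClosedElt (l := (⊤ : Filter Unit)) he
    (isLimit_eval (v := fun _ => V.prop) he V ρ hα fun q s => ?_)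
  exact .inl (hv ▸ isLimit_const_map he (v q))

theorem isOpenElt_eval (he : IsCanonicalExtension e) (hV : V.IsAdmissible e) {α : Form}
    (hα : α.SynOpen) : IsOpenElt e (eval e V α (e ∘ ρ)) := by
  obtain ⟨v, hv⟩ := hV
  refine IsOpenLimit.isOpenElt (l := (⊤ : Filter Unit)) he
    (isLimit_eval (v := fun _ => V.prop) he V ρ hα fun q s => ?_)
  exact .inl (hv ▸ isLimit_const_map he (v q))

theorem IsClosedElt.exists_forall_holds_setProp (he : IsCanonicalExtension e)
    (hV : V.IsAdmissible e) {k : C} (hk : IsClosedElt e k) {B : Multiset Ineq}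
    (hB : ∀ I ∈ B, I.lhs.PosIn p ∧ I.lhs.SynClosed ∧ I.rhs.NegIn p ∧ I.rhs.SynOpen)
    (h : ∀ I ∈ B, I.Holds e (V.setProp p k) (e ∘ ρ)) :
    ∃ a, k ≤ e a ∧ ∀ I ∈ B, I.Holds e (V.setProp p (e a)) (e ∘ ρ) := by
  have hdir : IsCodirectedOrder {a // k ≤ e a} :=
    (directedOn_ge_setOf_le_map k).isCodirectedOrder
  have hne : Nonempty {a // k ≤ e a} := ⟨⊤, le_top.trans_eq (map_top e).symm⟩
  have hev : ∀ᶠ a : {a // k ≤ e a} in Filter.atBot,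
      ∀ I ∈ B, I.Holds e (V.setProp p (e a)) (e ∘ ρ) :=
    (Filter.eventually_all_finite (Multiset.finite_toSet B)).2 fun I hI =>
      have ⟨hlp, hl, hrp, hr⟩ := hB I hI
      I.eventually_holds_setProp (b := false) he hV (hk.isClosedLimit_atBot he) ⟨hlp, hl⟩
        ⟨hrp, hr⟩ (h I hI)
  obtain ⟨⟨a, ha⟩, hBa⟩ := hev.exists
  exact ⟨a, ha, hBa⟩

theorem IsOpenElt.exists_forall_holds_setProp (he : IsCanonicalExtension e)
    (hV : V.IsAdmissible e) {u : C} (hu : IsOpenElt e u) {B : Multiset Ineq}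
    (hB : ∀ I ∈ B, I.lhs.NegIn p ∧ I.lhs.SynClosed ∧ I.rhs.PosIn p ∧ I.rhs.SynOpen)
    (h : ∀ I ∈ B, I.Holds e (V.setProp p u) (e ∘ ρ)) :
    ∃ a, e a ≤ u ∧ ∀ I ∈ B, I.Holds e (V.setProp p (e a)) (e ∘ ρ) := by
  have hdir : IsDirectedOrder {a // e a ≤ u} :=
    (directedOn_le_setOf_map_le u).isDirectedOrder
  have hne : Nonempty {a // e a ≤ u} := ⟨⊥, (map_bot e).trans_le bot_le⟩
  have hev : ∀ᶠ a : {a // e a ≤ u} in Filter.atTop,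
      ∀ I ∈ B, I.Holds e (V.setProp p (e a)) (e ∘ ρ) :=
    (Filter.eventually_all_finite (Multiset.finite_toSet B)).2 fun I hI =>
      have ⟨hlp, hl, hrp, hr⟩ := hB I hI
      I.eventually_holds_setProp (b := true) he hV (hu.isOpenLimit_atTop he) ⟨hlp, hl⟩
        ⟨hrp, hr⟩ (h I hI)
  obtain ⟨⟨a, ha⟩, hBa⟩ := hev.exists
  exact ⟨a, ha, hBa⟩

variable {αs : List Form} {B R : Multiset Ineq} {c : Ineq}

theorem fails_rightAckermann (he : IsCanonicalExtension e) {ρ : ℕ → C}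
    (hα : ∀ α ∈ αs, α.IsSentence) (hB : ∀ I ∈ B, I.lhs.PosIn p ∧ I.rhs.NegIn p)
    (h : (⟨(αs.map fun α => ⟨α, .prop p⟩ : List Ineq) + B + R, c⟩ : QuasiIneq).Fails e V ρ) :
    (⟨B.map (Ineq.subst p (Form.bigOr αs)) + R, c⟩ : QuasiIneq).Fails e V ρ := by
  rw [QuasiIneq.fails_add_iff] at h ⊢
  refine ⟨Multiset.forall_mem_map_iff.2 fun I hI => ?_, h.2⟩
  have hle : eval e V (Form.bigOr αs) ρ ≤ V.prop p :=
    eval_bigOr_le_iff.2 fun α hαs => h.1 ⟨α, .prop p⟩ (by simp [hαs])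
  have hIV : I.Holds e (V.setProp p (V.prop p)) ρ :=
    (V.setProp_self p).symm ▸ h.1 I (by simp [hI])
  exact (Ineq.holds_subst_iff (Form.isSentence_bigOr hα)).2
    (I.signedMonotone_holds (s := false) he V (hB I hI).1 (hB I hI).2 ρ hle hIV)

theorem fails_leftAckermann (he : IsCanonicalExtension e) {ρ : ℕ → C}
    (hα : ∀ α ∈ αs, α.IsSentence) (hB : ∀ I ∈ B, I.lhs.NegIn p ∧ I.rhs.PosIn p)
    (h : (⟨(αs.map fun α => ⟨.prop p, α⟩ : List Ineq) + B + R, c⟩ : QuasiIneq).Fails e V ρ) :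
    (⟨B.map (Ineq.subst p (Form.bigAnd αs)) + R, c⟩ : QuasiIneq).Fails e V ρ := by
  rw [QuasiIneq.fails_add_iff] at h ⊢
  refine ⟨Multiset.forall_mem_map_iff.2 fun I hI => ?_, h.2⟩
  have hle : V.prop p ≤ eval e V (Form.bigAnd αs) ρ :=
    le_eval_bigAnd_iff.2 fun α hαs => h.1 ⟨.prop p, α⟩ (by simp [hαs])
  have hIV : I.Holds e (V.setProp p (V.prop p)) ρ :=
    (V.setProp_self p).symm ▸ h.1 I (by simp [hI])
  exact (Ineq.holds_subst_iff (Form.isSentence_bigAnd hα)).2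
    (I.signedMonotone_holds (s := true) he V (hB I hI).1 (hB I hI).2 ρ hle hIV)

theorem exists_isAdmissible_fails_of_rightAckermann (he : IsCanonicalExtension e)
    (hV : V.IsAdmissible e) (hs : ∀ α ∈ αs, α.IsSentence)
    (hα : ∀ α ∈ αs, p ∉ α.props ∧ α.SynClosed)
    (hB : ∀ I ∈ B, I.lhs.PosIn p ∧ I.lhs.SynClosed ∧ I.rhs.NegIn p ∧ I.rhs.SynOpen)
    (hR : ∀ I ∈ R, I.PropFree p) (hc : c.PropFree p)
    (h : (⟨B.map (Ineq.subst p (Form.bigOr αs)) + R, c⟩ : QuasiIneq).Fails e V (e ∘ ρ)) :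
    ∃ W : Assignment C, W.IsAdmissible e ∧
      (⟨(αs.map fun α => ⟨α, .prop p⟩ : List Ineq) + B + R, c⟩ : QuasiIneq).Fails e W (e ∘ ρ) := by
  simp only [QuasiIneq.fails_add_iff, Multiset.forall_mem_map_iff,
    Ineq.holds_subst_iff (Form.isSentence_bigOr hs)] at h
  have hclosed : IsClosedElt e (eval e V (Form.bigOr αs) (e ∘ ρ)) :=
    isClosedElt_eval he hV (Form.synOC_bigOr fun α hαs => (hα α hαs).2)
  obtain ⟨a, ha, hBa⟩ := hclosed.exists_forall_holds_setProp he hV hB h.1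
  refine ⟨_, hV.setProp p a, QuasiIneq.fails_add_iff.2 ⟨fun I hI => ?_,
    (QuasiIneq.fails_setProp_iff hR hc _).2 h.2⟩⟩
  simp only [Multiset.mem_add, Multiset.mem_coe, List.mem_map] at hI
  obtain ⟨α, hαs, rfl⟩ | hI := hI
  · rw [Ineq.Holds, eval_setProp_of_notMem (hα α hαs).1]
    simpa [eval, Assignment.setProp] using eval_bigOr_le_iff.1 ha α hαs
  · exact hBa I hI

theorem exists_isAdmissible_fails_of_leftAckermann (he : IsCanonicalExtension e)
    (hV : V.IsAdmissible e) (hs : ∀ α ∈ αs, α.IsSentence)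
    (hα : ∀ α ∈ αs, p ∉ α.props ∧ α.SynOpen)
    (hB : ∀ I ∈ B, I.lhs.NegIn p ∧ I.lhs.SynClosed ∧ I.rhs.PosIn p ∧ I.rhs.SynOpen)
    (hR : ∀ I ∈ R, I.PropFree p) (hc : c.PropFree p)
    (h : (⟨B.map (Ineq.subst p (Form.bigAnd αs)) + R, c⟩ : QuasiIneq).Fails e V (e ∘ ρ)) :
    ∃ W : Assignment C, W.IsAdmissible e ∧
      (⟨(αs.map fun α => ⟨.prop p, α⟩ : List Ineq) + B + R, c⟩ : QuasiIneq).Fails e W (e ∘ ρ) := by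
  simp only [QuasiIneq.fails_add_iff, Multiset.forall_mem_map_iff,
    Ineq.holds_subst_iff (Form.isSentence_bigAnd hs)] at h
  have hopen : IsOpenElt e (eval e V (Form.bigAnd αs) (e ∘ ρ)) :=
    isOpenElt_eval he hV (Form.synOC_bigAnd fun α hαs => (hα α hαs).2)
  obtain ⟨a, ha, hBa⟩ := hopen.exists_forall_holds_setProp he hV hB h.1
  refine ⟨_, hV.setProp p a, QuasiIneq.fails_add_iff.2 ⟨fun I hI => ?_,
    (QuasiIneq.fails_setProp_iff hR hc _).2 h.2⟩⟩
  simp only [Multiset.mem_add, Multiset.mem_coe, List.mem_map] at hI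
  obtain ⟨α, hαs, rfl⟩ | hI := hI
  · rw [Ineq.Holds, eval_setProp_of_notMem (φ := α) (hα α hαs).1]
    simpa [eval, Assignment.setProp] using le_eval_bigAnd_iff.1 ha α hαs
  · exact hBa I hI

end Ackermann

/-! ## The approximation rules -/

section Approximation

variable {A : Type u} {C : Type v} [ModalBiHeyting A] [CompletelyDistribLattice C]
  {e : BoundedLatticeHom A C} {V : Assignment C} {ρ : ℕ → C} {Γ : Multiset Ineq} {c : Ineq}

theorem exists_fails_boxAppr (he : IsCanonicalExtension e) {ψ : Form} {m n : ℕ}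
    (hn : QuasiIneq.CnomFresh n ⟨⟨.box ψ, .cnom m⟩ ::ₘ Γ, c⟩)
    (h : (⟨⟨.box ψ, .cnom m⟩ ::ₘ Γ, c⟩ : QuasiIneq).Fails e V ρ) :
    ∃ W : Assignment C, (⟨⟨.box (.cnom n), .cnom m⟩ ::ₘ ⟨ψ, .cnom n⟩ ::ₘ Γ, c⟩ :
      QuasiIneq).Fails e W ρ := by
  simp only [QuasiIneq.fails_cons_iff, QuasiIneq.cnomFresh_cons_iff] at h hn ⊢
  obtain ⟨⟨hnψ, hnm⟩, hn⟩ := hn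
  obtain ⟨n', hn', hbox, hψ⟩ := he.exists_isCMI_boxExt_le (V.cnom_cmi m) h.1
  refine ⟨V.setCnom n n' hn', ?_, ?_, (hn.fails_setCnom_iff hn').2 h.2⟩
  · rw [Ineq.Holds, eval_setCnom_of_notMem hnm]
    simpa [eval, Assignment.setCnom] using hbox
  · rw [Ineq.Holds, eval_setCnom_of_notMem (φ := ψ) hnψ]
    simpa [eval, Assignment.setCnom] using hψ

theorem exists_fails_diaAppr (he : IsCanonicalExtension e) {ψ : Form} {j i : ℕ}
    (hi : QuasiIneq.NomFresh i ⟨⟨.nom j, .dia ψ⟩ ::ₘ Γ, c⟩)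
    (h : (⟨⟨.nom j, .dia ψ⟩ ::ₘ Γ, c⟩ : QuasiIneq).Fails e V ρ) :
    ∃ W : Assignment C, (⟨⟨.nom j, .dia (.nom i)⟩ ::ₘ ⟨.nom i, ψ⟩ ::ₘ Γ, c⟩ :
      QuasiIneq).Fails e W ρ := by
  simp only [QuasiIneq.fails_cons_iff, QuasiIneq.nomFresh_cons_iff] at h hi ⊢
  obtain ⟨⟨hij, hiψ⟩, hi⟩ := hi
  obtain ⟨i', hi', hdia, hψ⟩ := he.exists_isCJI_le_diaExt (V.nom_cji j) h.1
  refine ⟨V.setNom i i' hi', ?_, ?_, (hi.fails_setNom_iff hi').2 h.2⟩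
  · rw [Ineq.Holds, eval_setNom_of_notMem hij]
    simpa [eval, Assignment.setNom] using hdia
  · rw [Ineq.Holds, eval_setNom_of_notMem (φ := ψ) hiψ]
    simpa [eval, Assignment.setNom] using hψ

theorem exists_fails_impAppr (he : IsCanonicalExtension e) {χ φ : Form} {m j n : ℕ}
    (hj : QuasiIneq.NomFresh j ⟨⟨.imp χ φ, .cnom m⟩ ::ₘ Γ, c⟩)
    (hn : QuasiIneq.CnomFresh n ⟨⟨.imp χ φ, .cnom m⟩ ::ₘ Γ, c⟩)
    (h : (⟨⟨.imp χ φ, .cnom m⟩ ::ₘ Γ, c⟩ : QuasiIneq).Fails e V ρ) :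
    ∃ W : Assignment C,
      (⟨⟨.imp (.nom j) (.cnom n), .cnom m⟩ ::ₘ ⟨.nom j, χ⟩ ::ₘ ⟨φ, .cnom n⟩ ::ₘ Γ, c⟩ :
        QuasiIneq).Fails e W ρ := by
  simp only [QuasiIneq.fails_cons_iff, QuasiIneq.nomFresh_cons_iff,
    QuasiIneq.cnomFresh_cons_iff] at h hj hn ⊢
  obtain ⟨⟨hjimp, -⟩, hj⟩ := hj
  obtain ⟨⟨hnimp, hnm⟩, hn⟩ := hn
  obtain ⟨hjχ, hjφ⟩ := Finset.notMem_union.1 hjimp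
  obtain ⟨hnχ, hnφ⟩ := Finset.notMem_union.1 hnimp
  obtain ⟨j', n', hj', hn', himp, hχ, hφ⟩ := he.exists_isCJI_isCMI_himp_le (V.cnom_cmi m) h.1
  refine ⟨(V.setNom j j' hj').setCnom n n' hn', ?_, ?_, ?_,
    (hn.fails_setCnom_iff hn').2 ((hj.fails_setNom_iff hj').2 h.2)⟩
  · rw [Ineq.Holds, eval_setCnom_of_notMem hnm]
    simpa [eval, Assignment.setCnom, Assignment.setNom] using himp
  · rw [Ineq.Holds, eval_setCnom_of_notMem (φ := χ) hnχ, eval_setNom_of_notMem (φ := χ) hjχ]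
    simpa [eval, Assignment.setCnom, Assignment.setNom] using hχ
  · rw [Ineq.Holds, eval_setCnom_of_notMem (φ := φ) hnφ, eval_setNom_of_notMem (φ := φ) hjφ]
    simpa [eval, Assignment.setCnom, Assignment.setNom] using hφ

theorem exists_fails_subAppr (he : IsCanonicalExtension e) {χ φ : Form} {i j n : ℕ}
    (hj : QuasiIneq.NomFresh j ⟨⟨.nom i, .sub χ φ⟩ ::ₘ Γ, c⟩)
    (hn : QuasiIneq.CnomFresh n ⟨⟨.nom i, .sub χ φ⟩ ::ₘ Γ, c⟩)
    (h : (⟨⟨.nom i, .sub χ φ⟩ ::ₘ Γ, c⟩ : QuasiIneq).Fails e V ρ) :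
    ∃ W : Assignment C,
      (⟨⟨.nom i, .sub (.nom j) (.cnom n)⟩ ::ₘ ⟨.nom j, χ⟩ ::ₘ ⟨φ, .cnom n⟩ ::ₘ Γ, c⟩ :
        QuasiIneq).Fails e W ρ := by
  simp only [QuasiIneq.fails_cons_iff, QuasiIneq.nomFresh_cons_iff,
    QuasiIneq.cnomFresh_cons_iff] at h hj hn ⊢
  obtain ⟨⟨hji, hjsub⟩, hj⟩ := hj
  obtain ⟨⟨hni, hnsub⟩, hn⟩ := hn
  obtain ⟨hjχ, hjφ⟩ := Finset.notMem_union.1 hjsub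
  obtain ⟨hnχ, hnφ⟩ := Finset.notMem_union.1 hnsub
  obtain ⟨j', n', hj', hn', hsub, hχ, hφ⟩ := he.exists_isCJI_isCMI_le_sdiff (V.nom_cji i) h.1
  refine ⟨(V.setNom j j' hj').setCnom n n' hn', ?_, ?_, ?_,
    (hn.fails_setCnom_iff hn').2 ((hj.fails_setNom_iff hj').2 h.2)⟩
  · rw [Ineq.Holds, eval_setCnom_of_notMem hni, eval_setNom_of_notMem hji]
    simpa [eval, Assignment.setCnom, Assignment.setNom] using hsub
  · rw [Ineq.Holds, eval_setCnom_of_notMem (φ := χ) hnχ, eval_setNom_of_notMem (φ := χ) hjχ]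
    simpa [eval, Assignment.setCnom, Assignment.setNom] using hχ
  · rw [Ineq.Holds, eval_setCnom_of_notMem (φ := φ) hnφ, eval_setNom_of_notMem (φ := φ) hjφ]
    simpa [eval, Assignment.setCnom, Assignment.setNom] using hφ

end Approximation

/-! ## Tame runs -/

section Run

theorem LocalRule.isSentence {I : Ineq} {S : Multiset Ineq} (h : LocalRule I S)
    (hI : I.IsSentence) : ∀ J ∈ S, J.IsSentence := by
  cases h <;> simp_all [Ineq.IsSentence, Form.IsSentence, Form.freeVars, Finset.union_eq_empty]

theorem TameStep.isSentence {Q Q' : QuasiIneq} (h : TameStep Q Q')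
    (hQ : ∀ I ∈ Q.ante, I.IsSentence) : ∀ I ∈ Q'.ante, I.IsSentence := by
  cases h with
  | loc Γ c hr =>
    rw [Multiset.forall_mem_cons] at hQ
    exact fun J hJ => (Multiset.mem_add.1 hJ).elim (hr.isSentence hQ.1 J) (hQ.2 J)
  | boxAppr | diaAppr | impAppr | subAppr =>
    simp_all [Ineq.IsSentence, Form.IsSentence, Form.freeVars, Finset.union_eq_empty]
  | rightAckermann p αs B R c hα hB hR hc =>
    simp only [Multiset.mem_add, or_imp, forall_and, Multiset.forall_mem_map_iff] at hQ ⊢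
    have hs : (Form.bigOr αs).IsSentence := Form.isSentence_bigOr fun α hαs =>
      (hQ.1.1 ⟨α, .prop p⟩ (by simp [hαs])).1
    exact ⟨fun I hI => ⟨(hQ.1.2 I hI).1.subst hs p, (hQ.1.2 I hI).2.subst hs p⟩, hQ.2⟩
  | leftAckermann p αs B R c hα hB hR hc =>
    simp only [Multiset.mem_add, or_imp, forall_and, Multiset.forall_mem_map_iff] at hQ ⊢
    have hs : (Form.bigAnd αs).IsSentence := Form.isSentence_bigAnd fun α hαs =>
      (hQ.1.1 ⟨.prop p, α⟩ (by simp [hαs])).2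
    exact ⟨fun I hI => ⟨(hQ.1.2 I hI).1.subst hs p, (hQ.1.2 I hI).2.subst hs p⟩, hQ.2⟩

variable {A : Type u} {C : Type v} [ModalBiHeyting A] [CompletelyDistribLattice C]
  {e : BoundedLatticeHom A C} {Q Q' : QuasiIneq}

theorem LocalRule.holds_iff (he : IsCanonicalExtension e) {I : Ineq} {S : Multiset Ineq}
    (h : LocalRule I S) (V : Assignment C) (ρ : ℕ → C) :
    I.Holds e V ρ ↔ ∀ J ∈ S, J.Holds e V ρ := by
  cases h with
  | subLR χ ψ φ => simp [Ineq.Holds, eval, sdiff_le_iff]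
  | impRR φ χ ψ => simp [Ineq.Holds, eval, le_himp_iff]
  | andLR χ ψ φ => simp [Ineq.Holds, eval, le_himp_iff]
  | andLR' χ ψ φ => simp [Ineq.Holds, eval, le_himp_iff, inf_comm]
  | orRR φ χ ψ => simp [Ineq.Holds, eval, sdiff_le_iff]
  | orRR' φ χ ψ => simp [Ineq.Holds, eval, sdiff_le_iff, sup_comm]
  | orLA φ χ ψ => simp [Ineq.Holds, eval]
  | andRA ψ φ χ => simp [Ineq.Holds, eval]
  | diaLA φ ψ => simpa [Ineq.Holds, eval] using he.gc_diaExt_bboxExt _ _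
  | boxRA φ ψ => simpa [Ineq.Holds, eval] using (he.gc_bdiaExt_boxExt _ _).symm

theorem LocalRule.fails_iff (he : IsCanonicalExtension e) {I : Ineq} {S : Multiset Ineq}
    (h : LocalRule I S) (V : Assignment C) (ρ : ℕ → C) (Γ : Multiset Ineq) (c : Ineq) :
    (⟨I ::ₘ Γ, c⟩ : QuasiIneq).Fails e V ρ ↔ (⟨S + Γ, c⟩ : QuasiIneq).Fails e V ρ := by
  rw [QuasiIneq.fails_cons_iff, QuasiIneq.fails_add_iff, h.holds_iff he]

theorem TameStep.exists_fails (he : IsCanonicalExtension e) (h : TameStep Q Q')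
    (hQ : ∀ I ∈ Q.ante, I.IsSentence) {V : Assignment C} {ρ : ℕ → C} (hV : Q.Fails e V ρ) :
    ∃ W : Assignment C, Q'.Fails e W ρ := by
  cases h with
  | loc Γ c hr => exact ⟨V, (hr.fails_iff he V ρ Γ c).1 hV⟩
  | boxAppr ψ m n Γ c hn => exact exists_fails_boxAppr he hn hV
  | diaAppr ψ j i Γ c hi => exact exists_fails_diaAppr he hi hV
  | impAppr χ φ m j n Γ c hj hn => exact exists_fails_impAppr he hj hn hV
  | subAppr χ φ i j n Γ c hj hn => exact exists_fails_subAppr he hj hn hV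
  | rightAckermann p αs B R c hα hB hR hc =>
    exact ⟨V, fails_rightAckermann he (fun α hαs => (hQ ⟨α, .prop p⟩ (by simp [hαs])).1)
      (fun I hI => ⟨(hB I hI).1, (hB I hI).2.2.1⟩) hV⟩
  | leftAckermann p αs B R c hα hB hR hc =>
    exact ⟨V, fails_leftAckermann he (fun α hαs => (hQ ⟨.prop p, α⟩ (by simp [hαs])).2)
      (fun I hI => ⟨(hB I hI).1, (hB I hI).2.2.1⟩) hV⟩

theorem TameStep.exists_isAdmissible_fails (he : IsCanonicalExtension e) (h : TameStep Q Q')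
    (hQ : ∀ I ∈ Q.ante, I.IsSentence) {V : Assignment C} (hV : V.IsAdmissible e) {ρ : ℕ → A}
    (hQ' : Q'.Fails e V (e ∘ ρ)) :
    ∃ W : Assignment C, W.IsAdmissible e ∧ Q.Fails e W (e ∘ ρ) := by
  cases h with
  | loc Γ c hr => exact ⟨V, hV, (hr.fails_iff he V _ Γ c).2 hQ'⟩
  | boxAppr ψ m n Γ c hn =>
    simp only [QuasiIneq.fails_cons_iff] at hQ' ⊢
    obtain ⟨hbox, hψ, hΓ⟩ := hQ'
    exact ⟨V, hV, (he.piExt_mono box_mono hψ).trans hbox, hΓ⟩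
  | diaAppr ψ j i Γ c hi =>
    simp only [QuasiIneq.fails_cons_iff] at hQ' ⊢
    obtain ⟨hdia, hψ, hΓ⟩ := hQ'
    exact ⟨V, hV, le_trans hdia (he.sigmaExt_mono dia_mono hψ), hΓ⟩
  | impAppr χ φ m j n Γ c hj hn =>
    simp only [QuasiIneq.fails_cons_iff] at hQ' ⊢
    obtain ⟨himp, hχ, hφ, hΓ⟩ := hQ'
    exact ⟨V, hV, (himp_le_himp hχ hφ).trans himp, hΓ⟩
  | subAppr χ φ i j n Γ c hj hn =>
    simp only [QuasiIneq.fails_cons_iff] at hQ' ⊢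
    obtain ⟨hsub, hχ, hφ, hΓ⟩ := hQ'
    exact ⟨V, hV, le_trans hsub (sdiff_le_sdiff hχ hφ), hΓ⟩
  | rightAckermann p αs B R c hα hB hR hc =>
    exact exists_isAdmissible_fails_of_rightAckermann he hV
      (fun α hαs => (hQ ⟨α, .prop p⟩ (by simp [hαs])).1) hα hB hR hc hQ'
  | leftAckermann p αs B R c hα hB hR hc =>
    exact exists_isAdmissible_fails_of_leftAckermann he hV
      (fun α hαs => (hQ ⟨.prop p, α⟩ (by simp [hαs])).2) hα hB hR hc hQ'

theorem QuasiIneq.IsPure.fails_congr (hQ : Q.IsPure) {V W : Assignment C} {ρ : ℕ → C}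
    (hnom : V.nom = W.nom) (hcnom : V.cnom = W.cnom) : Q.Fails e V ρ ↔ Q.Fails e W ρ := by
  have heval {φ : Form} (hφ : φ.props = ∅) : eval e V φ ρ = eval e W φ ρ :=
    eval_congr (by simp [hφ]) (fun j _ => congrFun hnom j) (fun m _ => congrFun hcnom m)
      fun _ _ => rfl
  have hholds {I : Ineq} (hI : I.IsPure) : I.Holds e V ρ ↔ I.Holds e W ρ := by
    rw [Ineq.Holds, Ineq.Holds, heval hI.1, heval hI.2]
  exact and_congr (forall₂_congr fun I hI => hholds (hQ.1 I hI)) (hholds hQ.2).not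

theorem exists_isAdmissible_fails_of_reflTransGen_tameStep (he : IsCanonicalExtension e)
    (h : Relation.ReflTransGen TameStep Q Q') (hQ' : Q'.IsPure)
    (hQ : ∀ I ∈ Q.ante, I.IsSentence) {V : Assignment C} {ρ : ℕ → A} (hV : Q.Fails e V (e ∘ ρ)) :
    ∃ W : Assignment C, W.IsAdmissible e ∧ Q.Fails e W (e ∘ ρ) := by
  induction h using Relation.ReflTransGen.head_induction_on generalizing V with
  | refl =>
    let W : Assignment C := { V with prop := fun _ => e ⊥ }
    exact ⟨W, ⟨fun _ => ⊥, rfl⟩, (hQ'.fails_congr (V := V) (W := W) rfl rfl).1 hV⟩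
  | head hstep _ ih =>
    obtain ⟨V', hV'⟩ := hstep.exists_fails he hQ hV
    obtain ⟨W, hW, hWfails⟩ := ih (hstep.isSentence hQ) hV'
    exact hstep.exists_isAdmissible_fails he hQ hW hWfails

end Run

/-! ## Preprocessing and first approximation -/

/-- The inequality obtained by replacing `μ`, `ν` by `μ*`, `ν*` on both sides. -/
def Ineq.star (I : Ineq) : Ineq := ⟨I.lhs.star, I.rhs.star⟩

theorem Ineq.star_subst (I : Ineq) (p : ℕ) (α : Form) :
    (I.subst p α).star = I.star.subst p α.star := by
  simp only [Ineq.star, Ineq.subst, Form.star_subst]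

/-- The inequalities between sentences without nominals and co-nominals. -/
def Ineq.IsPlain (I : Ineq) : Prop := I.lhs.IsPlain ∧ I.rhs.IsPlain

section Preprocessing

theorem Distrib.freeVars_eq {s : Bool} {φ φ' : Form} (h : Distrib s φ φ') :
    φ'.freeVars = φ.freeVars := by
  induction h <;> simp only [Form.freeVars] <;> grind

theorem Distrib.noms_eq {s : Bool} {φ φ' : Form} (h : Distrib s φ φ') : φ'.noms = φ.noms := by
  induction h <;> simp only [Form.noms] <;> grind

theorem Distrib.cnoms_eq {s : Bool} {φ φ' : Form} (h : Distrib s φ φ') :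
    φ'.cnoms = φ.cnoms := by
  induction h <;> simp only [Form.cnoms] <;> grind

theorem Distrib.isPlain {s : Bool} {φ φ' : Form} (h : Distrib s φ φ') (hφ : φ.IsPlain) :
    φ'.IsPlain :=
  ⟨h.freeVars_eq.trans hφ.isSentence, h.noms_eq.trans hφ.noms_eq, h.cnoms_eq.trans hφ.cnoms_eq⟩

theorem PreRule.isPlain {I : Ineq} {L : List Ineq} (h : PreRule I L) (hI : I.IsPlain) :
    ∀ J ∈ L, J.IsPlain := by
  obtain ⟨hl, hr⟩ := hI
  cases h with
  | distrib_left hd => simpa using ⟨hd.isPlain hl, hr⟩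
  | distrib_right hd => simpa using ⟨hl, hd.isPlain hr⟩
  | orLA α β γ =>
    rw [Form.isPlain_or] at hl
    simpa using ⟨⟨hl.1, hr⟩, hl.2, hr⟩
  | andRA α β γ =>
    rw [Form.isPlain_and] at hr
    simpa using ⟨⟨hl, hr.1⟩, hl, hr.2⟩
  | botElim p _ _ =>
    simpa using ⟨hl.subst Form.isPlain_bot p, hr.subst Form.isPlain_bot p⟩
  | topElim p _ _ =>
    simpa using ⟨hl.subst Form.isPlain_top p, hr.subst Form.isPlain_top p⟩

theorem PreStep.isPlain {L L' : List Ineq} (h : PreStep L L') (hL : ∀ I ∈ L, I.IsPlain) :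
    ∀ I ∈ L', I.IsPlain := by
  obtain ⟨L₁, L₂, hr⟩ := h
  simp only [List.forall_mem_append, List.forall_mem_cons] at hL ⊢
  exact ⟨⟨hL.1, hr.isPlain hL.2.1⟩, hL.2.2⟩

variable {A : Type u} {C : Type v} [ModalBiHeyting A] [CompletelyDistribLattice C]
  {e : BoundedLatticeHom A C} {P : Assignment C → Prop} {I : Ineq} {L L' : List Ineq}

theorem Distrib.eval_star_eq (he : IsCanonicalExtension e) {s : Bool} {φ φ' : Form}
    (h : Distrib s φ φ') (V : Assignment C) (ρ : ℕ → C) :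
    eval e V φ'.star ρ = eval e V φ.star ρ := by
  induction h generalizing ρ with
  | dia_or α β => exact he.gc_diaExt_bboxExt.l_sup.symm
  | and_or_left α β γ => exact (inf_sup_right _ _ _).symm
  | and_or_right α β γ => exact (inf_sup_left _ _ _).symm
  | box_and α β => exact he.gc_bdiaExt_boxExt.u_inf.symm
  | or_and_left α β γ => exact (sup_inf_right _ _ _).symm
  | or_and_right α β γ => exact (sup_inf_left _ _ _).symm
  | _ => simp only [Form.star, eval, *]

theorem forall_holds_iff_forall_holds_subst {p : ℕ} {α : Form} (hα : α.IsSentence) {a : A}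
    {ρ : ℕ → C} (hαa : ∀ V : Assignment C, eval e V α ρ = e a)
    (hP : ∀ V p a, P V → P (V.setProp p (e a)))
    (hI : ∀ V : Assignment C, I.Holds e (V.setProp p (e a)) ρ → I.Holds e V ρ) :
    (∀ V, P V → I.Holds e V ρ) ↔ ∀ V, P V → (I.subst p α).Holds e V ρ := by
  simp only [Ineq.holds_subst_iff hα, hαa]
  exact ⟨fun h V hV => h _ (hP V p a hV), fun h V hV => hI V (h V hV)⟩

theorem PreRule.forall_holds_star_iff (he : IsCanonicalExtension e) (h : PreRule I L)
    (hP : ∀ V p a, P V → P (V.setProp p (e a))) (ρ : ℕ → C) :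
    (∀ V, P V → I.star.Holds e V ρ) ↔ ∀ J ∈ L, ∀ V, P V → J.star.Holds e V ρ := by
  cases h with
  | distrib_left hd =>
    simp only [List.mem_singleton, forall_eq, Ineq.Holds, Ineq.star, hd.eval_star_eq he]
  | distrib_right hd =>
    simp only [List.mem_singleton, forall_eq, Ineq.Holds, Ineq.star, hd.eval_star_eq he]
  | orLA α β γ =>
    simp only [List.forall_mem_cons, List.not_mem_nil, IsEmpty.forall_iff, implies_true, and_true,
      Ineq.Holds, Ineq.star, Form.star, eval, sup_le_iff, imp_and, forall_and]
  | andRA α β γ =>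
    simp only [List.forall_mem_cons, List.not_mem_nil, IsEmpty.forall_iff, implies_true, and_true,
      Ineq.Holds, Ineq.star, Form.star, eval, le_inf_iff, imp_and, forall_and]
  | @botElim α β p hα hβ =>
    rw [List.forall_mem_singleton]
    change _ ↔ ∀ V, P V → (Ineq.subst p .bot ⟨α, β⟩).star.Holds e V ρ
    rw [Ineq.star_subst]
    refine forall_holds_iff_forall_holds_subst Form.isPlain_bot.isSentence (a := ⊥)
      (fun _ => (map_bot e).symm) hP fun V hV => ?_
    have hmono := Ineq.signedMonotone_holds (I := Ineq.star ⟨α, β⟩) (s := true) he V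
      (Form.propSign_star.2 hα) (Form.propSign_star.2 hβ) ρ
    simpa only [Assignment.setProp_self] using
      hmono ((map_bot e).trans_le bot_le : e ⊥ ≤ V.prop p) hV
  | @topElim α β p hα hβ =>
    rw [List.forall_mem_singleton]
    change _ ↔ ∀ V, P V → (Ineq.subst p .top ⟨α, β⟩).star.Holds e V ρ
    rw [Ineq.star_subst]
    refine forall_holds_iff_forall_holds_subst Form.isPlain_top.isSentence (a := ⊤)
      (fun _ => (map_top e).symm) hP fun V hV => ?_
    have hanti := Ineq.signedMonotone_holds (I := Ineq.star ⟨α, β⟩) (s := false) he V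
      (Form.propSign_star.2 hα) (Form.propSign_star.2 hβ) ρ
    simpa only [Assignment.setProp_self] using
      hanti (le_top.trans_eq (map_top e).symm : V.prop p ≤ e ⊤) hV

theorem PreStep.forall_holds_star_iff (he : IsCanonicalExtension e) (h : PreStep L L')
    (hP : ∀ V p a, P V → P (V.setProp p (e a))) (ρ : ℕ → C) :
    (∀ I ∈ L, ∀ V, P V → I.star.Holds e V ρ) ↔ ∀ I ∈ L', ∀ V, P V → I.star.Holds e V ρ := by
  obtain ⟨L₁, L₂, hr⟩ := h
  simp only [List.forall_mem_append, List.forall_mem_cons]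
  rw [hr.forall_holds_star_iff he hP, and_assoc]

theorem isPlain_of_reflTransGen_preStep (h : Relation.ReflTransGen PreStep L L')
    (hL : ∀ I ∈ L, I.IsPlain) : ∀ I ∈ L', I.IsPlain := by
  induction h with
  | refl => exact hL
  | tail _ hstep ih => exact hstep.isPlain ih

theorem forall_holds_star_iff_of_reflTransGen_preStep (he : IsCanonicalExtension e)
    (h : Relation.ReflTransGen PreStep L L') (hP : ∀ V p a, P V → P (V.setProp p (e a)))
    (ρ : ℕ → C) :
    (∀ I ∈ L, ∀ V, P V → I.star.Holds e V ρ) ↔ ∀ I ∈ L', ∀ V, P V → I.star.Holds e V ρ := by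
  induction h with
  | refl => rfl
  | tail _ hstep ih => exact ih.trans (hstep.forall_holds_star_iff he hP ρ)

theorem firstApprox_isSentence (hI : I.IsPlain) (j m : ℕ) :
    ∀ J ∈ (firstApprox j m I).ante, J.IsSentence := by
  simp only [firstApprox, Multiset.insert_eq_cons, Multiset.forall_mem_cons,
    Multiset.mem_singleton, forall_eq, Ineq.IsSentence, Form.isSentence_star]
  exact ⟨⟨rfl, hI.1.isSentence⟩, hI.2.isSentence, rfl⟩

variable {V : Assignment C} {ρ : ℕ → C} {j m : ℕ}

theorem fails_firstApprox_iff :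
    (firstApprox j m I).Fails e V ρ ↔
      V.nom j ≤ eval e V I.lhs.star ρ ∧ eval e V I.rhs.star ρ ≤ V.cnom m ∧
        ¬ V.nom j ≤ V.cnom m := by
  simp only [firstApprox, QuasiIneq.Fails, Multiset.insert_eq_cons, Multiset.forall_mem_cons,
    Multiset.mem_singleton, forall_eq, Ineq.Holds, eval, and_assoc]

theorem not_holds_star_of_fails_firstApprox (h : (firstApprox j m I).Fails e V ρ) :
    ¬ I.star.Holds e V ρ := by
  obtain ⟨hj, hm, hjm⟩ := fails_firstApprox_iff.1 h
  exact fun hI => hjm (hj.trans (le_trans hI hm))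

theorem exists_fails_firstApprox (he : IsCanonicalExtension e) (hI : I.IsPlain)
    (h : ¬ I.star.Holds e V ρ) (j m : ℕ) :
    ∃ W : Assignment C, (firstApprox j m I).Fails e W ρ := by
  obtain ⟨j', m', hj', hm', hj, hm, hjm⟩ := he.exists_isCJI_isCMI_of_not_le h
  let W : Assignment C := (V.setNom j j' hj').setCnom m m' hm'
  have heval {φ : Form} (hφ : φ.IsPlain) : eval e W φ.star ρ = eval e V φ.star ρ := by
    rw [eval_setCnom_of_notMem (by simp [hφ.cnoms_eq]),
      eval_setNom_of_notMem (by simp [hφ.noms_eq])]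
  refine ⟨W, fails_firstApprox_iff.2 ?_⟩
  rw [heval hI.1, heval hI.2]
  simpa only [W, Assignment.setCnom, Assignment.setNom, Function.update_self] using ⟨hj, hm, hjm⟩

theorem holds_star_of_forall_isAdmissible (he : IsCanonicalExtension e) (hI : I.IsPlain)
    {Q : QuasiIneq} (hrun : Relation.ReflTransGen TameStep (firstApprox j m I) Q) (hQ : Q.IsPure)
    {ρ : ℕ → A} (h : ∀ W : Assignment C, W.IsAdmissible e → I.star.Holds e W (e ∘ ρ)) :
    I.star.Holds e V (e ∘ ρ) := by
  by_contra hV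
  obtain ⟨V', hV'⟩ := exists_fails_firstApprox he hI hV j m
  obtain ⟨W, hW, hWfails⟩ := exists_isAdmissible_fails_of_reflTransGen_tameStep he hrun hQ
    (firstApprox_isSentence hI j m) hV'
  exact not_holds_star_of_fails_firstApprox hWfails (h W hW)

theorem TameRunSucceeds.eval_star_le_eval_star (he : IsCanonicalExtension e) {φ ψ : Form}
    (hφ : φ.IsPlain) (hψ : ψ.IsPlain) (hrun : TameRunSucceeds φ ψ) {ρ : ℕ → A}
    (h : ∀ W : Assignment C, W.IsAdmissible e →
      eval e W φ.star (e ∘ ρ) ≤ eval e W ψ.star (e ∘ ρ)) :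
    eval e V φ.star (e ∘ ρ) ≤ eval e V ψ.star (e ∘ ρ) := by
  obtain ⟨L, hL, hrun⟩ := hrun
  have hplain := isPlain_of_reflTransGen_preStep hL (List.forall_mem_singleton.2 ⟨hφ, hψ⟩)
  have hadmissible := (forall_holds_star_iff_of_reflTransGen_preStep he hL
    (P := Assignment.IsAdmissible e) (fun _ p a hV => hV.setProp p a) (e ∘ ρ)).1
    (List.forall_mem_singleton.2 h)
  refine (forall_holds_star_iff_of_reflTransGen_preStep he hL (P := fun _ : Assignment C => True)
    (fun _ _ _ _ => trivial) (e ∘ ρ)).2 (fun I hI W _ => ?_) _ (List.mem_singleton_self _) V trivial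
  obtain ⟨j, m, Q, hQrun, hQ⟩ := hrun I hI
  exact holds_star_of_forall_isAdmissible he (hplain I hI) hQrun hQ (hadmissible I hI)

end Preprocessing

end MuALBA

theorem mainTheorem2 (φ ψ : MuALBA.Form) (hφ : φ.IsL1) (hψ : ψ.IsL1)
    (hφs : φ.IsSentence) (hψs : ψ.IsSentence) (hrun : MuALBA.TameRunSucceeds φ ψ) :
    MuALBA.IsTameCanonical.{u, v} φ ψ := by
  intro A _ hA C _ e he
  rw [hA.validIn_iff he hφ hψ]
  refine ⟨fun hadmissible V ρ => ?_, fun hvalid V _ ρ => hvalid V _⟩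
  rw [MuALBA.eval_eq_of_isSentence (MuALBA.Form.isSentence_star.2 hφs) ρ (e ∘ fun _ => ⊥),
    MuALBA.eval_eq_of_isSentence (MuALBA.Form.isSentence_star.2 hψs) ρ (e ∘ fun _ => ⊥)]
  exact hrun.eval_star_le_eval_star he (hφ.isPlain hφs) (hψ.isPlain hψs)
    fun W hW => hadmissible W hW _
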